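/- Let $S$ be the plane $\mathbb R^2$ or the sphere $\mathbb S^2$, with its standard orientation. An oriented link diagram $\mathcal D$ in $S$ is a finite (possibly empty) collection of oriented closed curves in $S$, $C^1$ and immersed, whose only multiple points are finitely many transverse double points (the crossings), together with a choice at each crossing of which of the two strands passes under. The universe of $\mathcal D$ is the union of the curves. The arcs of $\mathcal D$ are the connected components of the curves after they are cut at the undercrossing points, and the regions of $\mathcal D$ are the connected components of the complement of the universe in $S$. The Wirtinger group $\pi_{wirt}$ is generated by the arcs, with one relation $ab = ca$ for each crossing, where $a$ is the overcrossing arc, $c$ is the undercrossing arc on the right of the oriented arc $a$, and $b$ is the undercrossing arc on the left of $a$. Given a base region $R_0$, the Dehn group $\pi_{dehn}$ is generated by the regions, with the relation $R_0 = 1$ and one relation $A^{-1}B = C^{-1}D$ for each crossing, where the overcrossing strand separates $A$ from $B$ on one side of the undercrossing strand and $C$ from $D$ on the other, and $A$ and $C$ lie on the same side of the overcrossing strand. Then for every oriented link diagram $\mathcal D$ in $S$ and every choice of base region $R_0$, the groups $\pi_{wirt}$ and $\pi_{dehn}$ are isomorphic. In particular this holds for every diagram of an oriented link in $\mathbb R^3$.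 -/

import Mathlib

open Set Filter Topology

noncomputable section

namespace LinkDiag

/-- Euclidean three-space. -/
abbrev E3 : Type := EuclideanSpace ℝ (Fin 3)

/-- The two surfaces in which diagrams are drawn: the plane and the 2-sphere. -/
inductive Surface : Type
  | plane
  | sphere

/-- The plane is the horizontal coordinate plane; the sphere is the unit sphere. -/
def Surface.carrier : Surface → Set E3
  | .plane => {x | x 2 = 0}
  | .sphere => Metric.sphere 0 1

/-- The unit normal that orients the surface (upward, respectively outward).
Diagrams are viewed from the side to which it points. -/
def Surface.normal : Surface → E3 → E3
  | .plane, _ => !₂[0, 0, 1]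
  | .sphere, x => x

/-- The disjoint union of `n` oriented circles `ℝ / ℤ`. -/
abbrev Circles (n : ℕ) : Type := Fin n × UnitAddCircle

/-- The velocity of a closed curve in a family, at a point of one of the circles. -/
def velocity {n : ℕ} (f : Circles n → E3) (p : Circles n) : E3 :=
  deriv (fun x : ℝ => f (p.1, p.2 + (x : UnitAddCircle))) 0

end LinkDiag

open LinkDiag in
/-- An oriented link diagram in the surface `S`: finitely many oriented closed curves, `C¹` and
immersed, whose only multiple points are finitely many transverse double points, together with
the choice, at each double point, of the strand that passes under. -/
structure OrientedLinkDiagram (S : LinkDiag.Surface) where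
  /-- the number of components -/
  n : ℕ
  /-- the closed curves -/
  curve : Circles n → E3
  curve_mem : ∀ p, curve p ∈ S.carrier
  contDiff : ∀ i : Fin n, ContDiff ℝ 1 (fun x : ℝ => curve (i, (x : UnitAddCircle)))
  immersed : ∀ p, velocity curve p ≠ 0
  transverse : ∀ p q, p ≠ q → curve p = curve q →
    LinearIndependent ℝ ![velocity curve p, velocity curve q]
  no_triple : ∀ p q r, curve p = curve q → curve q = curve r → p = q ∨ q = r ∨ p = r
  finite_double : {p | ∃ q, q ≠ p ∧ curve q = curve p}.Finite
  /-- the points of the circles at which the link passes under itself -/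
  under : Set (Circles n)
  under_double : ∀ p ∈ under, ∃ q, q ≠ p ∧ curve q = curve p
  under_iff : ∀ p q, p ≠ q → curve p = curve q → (p ∈ under ↔ q ∉ under)

namespace OrientedLinkDiagram

open LinkDiag

variable {S : LinkDiag.Surface} (D : OrientedLinkDiagram S)

/-- The underlying 4-valent graph, as a subset of the surface. -/
def shadow : Set E3 := Set.range D.curve

/-- The arcs of the diagram: the connected components of what remains of the circles when the
diagram is broken at its undercrossings. -/
def Arc : Type := ConnectedComponents {p : Circles D.n // p ∉ D.under}

/-- The arc that contains a given point. -/
def arcAt (p : Circles D.n) (h : p ∉ D.under) : D.Arc :=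
  ConnectedComponents.mk (⟨p, h⟩ : {p : Circles D.n // p ∉ D.under})

/-- The regions of the diagram: the connected components of the complement of the underlying
graph in the surface. -/
def Region : Type := ConnectedComponents {x : E3 // x ∈ S.carrier \ D.shadow}

/-- The region that contains a given point. -/
def regionAt (x : E3) (h : x ∈ S.carrier \ D.shadow) : D.Region :=
  ConnectedComponents.mk (⟨x, h⟩ : {x : E3 // x ∈ S.carrier \ D.shadow})

/-- `p` and `q` are the overcrossing point and the undercrossing point of a crossing. -/
def IsCrossing (p q : Circles D.n) : Prop :=
  p ≠ q ∧ D.curve p = D.curve q ∧ p ∉ D.under ∧ q ∈ D.under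

/-- `a` is the arc that arrives at the point `q`. -/
def Arrives (a : D.Arc) (q : Circles D.n) : Prop :=
  ∀ᶠ ε : ℝ in 𝓝[>] 0, ∃ h, D.arcAt (q.1, q.2 - (ε : UnitAddCircle)) h = a

/-- `a` is the arc that departs from the point `q`. -/
def Departs (a : D.Arc) (q : Circles D.n) : Prop :=
  ∀ᶠ ε : ℝ in 𝓝[>] 0, ∃ h, D.arcAt (q.1, q.2 + (ε : UnitAddCircle)) h = a

/-- The determinant of the normal of the surface, the velocity at `p` and the velocity at `q`.
At a crossing it is positive if the strand of `q` runs from the right to the left of the strand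
of `p` (right-hand crossing), and negative if it runs from the left to the right. -/
def crossingDet (p q : Circles D.n) : ℝ :=
  Matrix.det (Matrix.of fun i j : Fin 3 =>
    (![S.normal (D.curve p), velocity D.curve p, velocity D.curve q] i : E3) j)

/-- `c` and `b` are the arcs on the right and on the left of the overcrossing strand at a crossing
with overcrossing point `p` and undercrossing point `q`. -/
def UnderArcs (p q : Circles D.n) (c b : D.Arc) : Prop :=
  (0 < D.crossingDet p q ∧ D.Arrives c q ∧ D.Departs b q) ∨
    (D.crossingDet p q < 0 ∧ D.Departs c q ∧ D.Arrives b q)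

/-- The Wirtinger relators, for the relation `a b = c a` at each crossing, where `a` is the
overcrossing arc, `c` is the undercrossing arc on the right of `a`, `b` that on its left. -/
def wirtingerRels : Set (FreeGroup D.Arc) :=
  {r | ∃ (p q : Circles D.n) (h : D.IsCrossing p q) (b c : D.Arc), D.UnderArcs p q c b ∧
    r = (FreeGroup.of (D.arcAt p h.2.2.1) * FreeGroup.of b) *
      (FreeGroup.of c * FreeGroup.of (D.arcAt p h.2.2.1))⁻¹}

/-- The group described by the Wirtinger presentation. -/
abbrev WirtingerGroup : Type := PresentedGroup D.wirtingerRels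

/-- The region `R` lies at the point `x` in the direction `v`: some curve that leaves `x` with
initial velocity `v` runs in `R`. -/
def RegionInDirection (R : D.Region) (x v : E3) : Prop :=
  ∃ c : ℝ → E3, c 0 = x ∧ HasDerivWithinAt c v (Set.Ici 0) 0 ∧
    ∀ᶠ ε : ℝ in 𝓝[>] 0, ∃ h, D.regionAt (c ε) h = R

/-- The Dehn relators, for the relation `A⁻¹ B = C⁻¹ D` at each crossing. Here the overcrossing
strand separates `A` from `B` on one side of the undercrossing strand and `C` from `D` on the
other, with `A` and `C` on the same side of the overcrossing strand. Exchanging `A` with `B` and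
`C` with `D`, or `A` with `C` and `B` with `D`, gives an equivalent relation, so that neither the
orientation of the link nor that of the surface matters. -/
def dehnRels : Set (FreeGroup D.Region) :=
  {r | ∃ (p q : Circles D.n) (_ : D.IsCrossing p q) (RA RB RC RD : D.Region),
    D.RegionInDirection RA (D.curve p) (-velocity D.curve p - velocity D.curve q) ∧
    D.RegionInDirection RB (D.curve p) (-velocity D.curve p + velocity D.curve q) ∧
    D.RegionInDirection RC (D.curve p) (velocity D.curve p - velocity D.curve q) ∧
    D.RegionInDirection RD (D.curve p) (velocity D.curve p + velocity D.curve q) ∧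
    r = ((FreeGroup.of RA)⁻¹ * FreeGroup.of RB) *
      ((FreeGroup.of RC)⁻¹ * FreeGroup.of RD)⁻¹}

/-- The group described by the Dehn presentation with base region `R₀`, which is set equal to the
identity. -/
abbrev DehnGroup (R₀ : D.Region) : Type :=
  PresentedGroup (insert (FreeGroup.of R₀) D.dehnRels)

end OrientedLinkDiagram

end

/-! Colour the circles by elements `m` of a group `G`, constant on arcs, and call a `G`-valued
function `F` on the regions a potential for `m` if crossing a strand from its right to its left
multiplies `F` on the right by the colour of the strand.

At a crossing there are four quadrants and four half-strands. If `F` is a potential, the two halves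
of the overstrand carry the same colour, and this says exactly that `A⁻¹B = C⁻¹D`. Conversely, if
`F` satisfies the Dehn relations, its jumps define a colour on each arc, and walking once around the
crossing gives `ab = ca`. In the other direction, the Wirtinger relation is the condition that the
four jumps around a crossing compose to the identity, so that a potential exists near it.

Near each point of the surface the potentials for a given colouring form a torsor under left
multiplication by constants (`IsColoring.isTorsorSheaf`). The diagram lies in a square inside one
planar chart. Local potentials are glued over a fine grid of this square, and then along its
connected boundary with the constant `1` outside (`IsTorsorSheaf.exists_global`); this replaces
simple connectedness. Since the surface is connected, a potential is determined by its value on `R₀`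
(`IsPotential.eq`).

Apply this to the two tautological functions. The regions, seen in the Dehn group, are a potential
for some colouring `μ` there; the arcs, seen in the Wirtinger group, are a colouring with a
potential `F` such that `F R₀ = 1`. They induce homomorphisms in both directions, and these are
mutually inverse because a potential determines its colouring, while a colouring and the value at
`R₀` determine the potential. -/

noncomputable section

/-! ### Gluing local sections that are unique up to a constant factor -/

namespace LinkDiag

/-- A predicate `V f x` ("`f` is a section at `x`") on functions with values in a group, on the
space `S`, that is local on the dense part `O` of `S` and for which the germs of sections at each
point are a torsor under left multiplication by constants. -/
structure IsTorsorSheaf {Y G : Type*} [TopologicalSpace Y] [Group G] (S O : Set Y)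
    (V : (Y → G) → Y → Prop) : Prop where
  neBot : ∀ x ∈ S, (𝓝[O] x).NeBot
  eventually : ∀ f, ∀ x ∈ S, V f x → ∀ᶠ y in 𝓝[S] x, V f y
  exists_at : ∀ x ∈ S, ∃ f, V f x
  unique : ∀ f g, ∀ x ∈ S, V f x → V g x → ∃ h : G, ∀ᶠ y in 𝓝[O] x, f y = h * g y
  congr : ∀ f g (h : G), ∀ x ∈ S, V g x → (∀ᶠ y in 𝓝[O] x, f y = h * g y) → V f x

namespace IsTorsorSheaf

variable {Y G : Type*} [TopologicalSpace Y] [Group G] {S O : Set Y} {V : (Y → G) → Y → Prop}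

/-- The local factor relating two sections is locally constant along `C`: near `x` the factors at
`x` and at `y` describe the same germ at `y`, and they can be compared there because `O` accumulates
at `y`. -/
theorem exists_const_of_isPreconnected (hV : IsTorsorSheaf S O V) {C : Set Y} (hC : C ⊆ S)
    (hC' : IsPreconnected C) {f g : Y → G} (hf : ∀ x ∈ C, V f x) (hg : ∀ x ∈ C, V g x) :
    ∃ h : G, ∀ x ∈ C, ∀ᶠ y in 𝓝[O] x, f y = h * g y := by
  let _ : TopologicalSpace G := ⊥
  have : DiscreteTopology G := ⟨rfl⟩
  have key : ∀ x, ∃ h : G, x ∈ C → ∀ᶠ y in 𝓝[O] x, f y = h * g y := by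
    intro x
    by_cases hx : x ∈ C
    · obtain ⟨h, hh⟩ := hV.unique f g x (hC hx) (hf x hx) (hg x hx)
      exact ⟨h, fun _ => hh⟩
    · exact ⟨1, fun h => absurd h hx⟩
  choose k hk using key
  have hcont : ContinuousOn k C := by
    intro x hx
    have h1 := eventually_nhds_nhdsWithin.2 (hk x hx)
    have h2 : ∀ᶠ y in 𝓝[C] x, k y = k x := by
      filter_upwards [nhdsWithin_le_nhds h1, self_mem_nhdsWithin] with y hy hyC
      have := hV.neBot y (hC hyC)
      obtain ⟨z, hz1, hz2⟩ := (hy.and (hk y hyC)).exists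
      exact mul_right_cancel (hz2.symm.trans hz1)
    exact (tendsto_const_nhds.congr' (h2.mono fun y hy => hy.symm) :)
  rcases C.eq_empty_or_nonempty with rfl | ⟨x₀, hx₀⟩
  · exact ⟨1, by simp⟩
  · refine ⟨k x₀, fun x hx => ?_⟩
    rw [hC'.constant hcont hx₀ hx]
    exact hk x hx

-- After `g` is rescaled by one constant, it agrees with `f` on `O` near the connected set `C`. One
-- may then use `f` on `A` and the rescaled `g` off `A`: within `K`, the switch takes place only
-- along `C`, where it is invisible.
open Classical in
theorem exists_merge (hV : IsTorsorSheaf S O V) (hO : O ⊆ S) {A C K : Set Y} (hC : C ⊆ S)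
    (hC' : IsPreconnected C) (hKS : K ⊆ S) {f g : Y → G} (hf : ∀ x ∈ C, V f x)
    (hg : ∀ x ∈ C, V g x)
    (hK : ∀ x ∈ K, (A ∈ 𝓝[S] x ∧ V f x) ∨ (Aᶜ ∈ 𝓝[S] x ∧ V g x) ∨ x ∈ C) :
    ∃ f', (∀ x ∈ A, f' x = f x) ∧ ∀ x ∈ K, V f' x := by
  obtain ⟨h, hh⟩ := hV.exists_const_of_isPreconnected hC hC' hf hg
  have hOS : ∀ x, 𝓝[O] x ≤ 𝓝[S] x := fun x => nhdsWithin_mono x hO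
  refine ⟨fun x => if x ∈ A then f x else h * g x, fun x hx => by simp [hx], fun x hx => ?_⟩
  rcases hK x hx with ⟨hA, hfx⟩ | ⟨hA, hgx⟩ | hxC
  · refine hV.congr _ f 1 x (hKS hx) hfx ?_
    filter_upwards [hOS x hA] with y hy
    simp [hy]
  · refine hV.congr _ g h x (hKS hx) hgx ?_
    filter_upwards [hOS x hA] with y hy
    have : y ∉ A := hy
    simp [this]
  · refine hV.congr _ g h x (hKS hx) (hg x hxC) ?_
    filter_upwards [hh x hxC] with y hy
    split_ifs
    · exact hy
    · rfl

variable {e : ℝ × ℝ → Y}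

/-- The interface of the two adjacent rectangles is a segment, hence connected. -/
theorem exists_merge_rect_fst (hV : IsTorsorSheaf S O V) (hO : O ⊆ S)
    (hmap : ∀ z, map e (𝓝 z) = 𝓝[S] (e z)) (hS : ∀ z, e z ∈ S) (hinj : e.Injective)
    {a m b c d : ℝ} (ham : a ≤ m) (hmb : m ≤ b) {f g : Y → G}
    (hf : ∀ z ∈ Icc a m ×ˢ Icc c d, V f (e z)) (hg : ∀ z ∈ Icc m b ×ˢ Icc c d, V g (e z)) :
    ∃ f', ∀ z ∈ Icc a b ×ˢ Icc c d, V f' (e z) := by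
  have hcont : Continuous e := continuous_iff_continuousAt.2 fun z =>
    (hmap z).le.trans nhdsWithin_le_nhds
  have hC' : IsPreconnected (e '' ({m} ×ˢ Icc c d)) :=
    (isPreconnected_singleton.prod isPreconnected_Icc).image _ hcont.continuousOn
  obtain ⟨f', -, h⟩ := hV.exists_merge hO (A := e '' {z | z.1 ≤ m}) (K := e '' (Icc a b ×ˢ Icc c d))
    (by rintro _ ⟨z, -, rfl⟩; exact hS z) hC' (by rintro _ ⟨z, -, rfl⟩; exact hS z) (f := f) (g := g)
    (by rintro _ ⟨z, ⟨hz, hz'⟩, rfl⟩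
        have : z.1 = m := hz
        exact hf z ⟨⟨by linarith, by linarith⟩, hz'⟩)
    (by rintro _ ⟨z, ⟨hz, hz'⟩, rfl⟩
        have : z.1 = m := hz
        exact hg z ⟨⟨by linarith, by linarith⟩, hz'⟩)
    (by
      rintro _ ⟨z, ⟨hz, hz'⟩, rfl⟩
      rcases lt_trichotomy z.1 m with h | h | h
      · refine Or.inl ⟨?_, hf z ⟨⟨hz.1, h.le⟩, hz'⟩⟩
        rw [← hmap]
        refine image_mem_map ?_
        filter_upwards [(isOpen_lt continuous_fst continuous_const).mem_nhds h] with y hy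
        exact le_of_lt hy
      · exact Or.inr (Or.inr ⟨z, ⟨h, hz'⟩, rfl⟩)
      · refine Or.inr (Or.inl ⟨?_, hg z ⟨⟨h.le, hz.2⟩, hz'⟩⟩)
        rw [← hmap, mem_map]
        filter_upwards [(isOpen_lt continuous_const continuous_fst).mem_nhds h] with y hy
        rintro ⟨y', hy', he⟩
        rw [hinj he] at hy'
        exact absurd hy' (not_le.2 hy))
  exact ⟨f', fun z hz => h _ ⟨z, hz, rfl⟩⟩

theorem exists_merge_rect_snd (hV : IsTorsorSheaf S O V) (hO : O ⊆ S)
    (hmap : ∀ z, map e (𝓝 z) = 𝓝[S] (e z)) (hS : ∀ z, e z ∈ S) (hinj : e.Injective)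
    {a b c m d : ℝ} (hcm : c ≤ m) (hmd : m ≤ d) {f g : Y → G}
    (hf : ∀ z ∈ Icc a b ×ˢ Icc c m, V f (e z)) (hg : ∀ z ∈ Icc a b ×ˢ Icc m d, V g (e z)) :
    ∃ f', ∀ z ∈ Icc a b ×ˢ Icc c d, V f' (e z) := by
  obtain ⟨f', h⟩ := hV.exists_merge_rect_fst (e := e ∘ Prod.swap) hO (a := c) (m := m) (b := d)
    (c := a) (d := b) (fun z => by
      rw [← Filter.map_map]
      have : map Prod.swap (𝓝 z) = 𝓝 z.swap := (Homeomorph.prodComm ℝ ℝ).map_nhds_eq z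
      rw [this, hmap]; rfl) (fun z => hS _) (hinj.comp Prod.swap_injective) hcm hmd (f := f)
      (g := g) (fun z hz => hf z.swap ⟨hz.2, hz.1⟩) (fun z hz => hg z.swap ⟨hz.2, hz.1⟩)
  exact ⟨f', fun z hz => h z.swap ⟨hz.2, hz.1⟩⟩

/-- A Lebesgue number subdivision yields a grid on each cell of which some section exists. Cells are
merged into horizontal strips, and strips into the square. -/
theorem exists_on_unitSquare (hV : IsTorsorSheaf S O V) (hO : O ⊆ S)
    (hmap : ∀ z, map e (𝓝 z) = 𝓝[S] (e z)) (hS : ∀ z, e z ∈ S) (hinj : e.Injective) :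
    ∃ f, ∀ z ∈ Icc (0 : ℝ) 1 ×ˢ Icc (0 : ℝ) 1, V f (e z) := by
  let ι : unitInterval × unitInterval → ℝ × ℝ := Prod.map (↑) (↑)
  have hι : Continuous ι := continuous_subtype_val.prodMap continuous_subtype_val
  obtain ⟨t, ht0, htm, ⟨N, hN⟩, ht⟩ := exists_monotone_Icc_subset_open_cover_unitInterval_prod_self
    (c := fun f : Y → G => ι ⁻¹' interior {z | V f (e z)})
    (fun f => isOpen_interior.preimage hι)
    (by
      intro w _
      obtain ⟨f, hf⟩ := hV.exists_at (e (ι w)) (hS _)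
      refine mem_iUnion.2 ⟨f, ?_⟩
      have := hV.eventually f _ (hS _) hf
      rw [← hmap] at this
      exact mem_interior_iff_mem_nhds.2 this)
  have hcell : ∀ n m : ℕ, ∃ f : Y → G, ∀ z ∈ Icc (t n : ℝ) (t (n + 1)) ×ˢ
      Icc (t m : ℝ) (t (m + 1)), V f (e z) := by
    intro n m
    obtain ⟨f, hf⟩ := ht n m
    refine ⟨f, fun z hz => ?_⟩
    have h1 : z.1 ∈ Icc (0 : ℝ) 1 := ⟨(t n).2.1.trans hz.1.1, hz.1.2.trans (t (n + 1)).2.2⟩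
    have h2 : z.2 ∈ Icc (0 : ℝ) 1 := ⟨(t m).2.1.trans hz.2.1, hz.2.2.trans (t (m + 1)).2.2⟩
    have := hf (a := (⟨z.1, h1⟩, ⟨z.2, h2⟩)) ⟨⟨hz.1.1, hz.1.2⟩, ⟨hz.2.1, hz.2.2⟩⟩
    exact interior_subset (s := {z | V f (e z)}) this
  have hle : ∀ n, (t n : ℝ) ≤ t (n + 1) := fun n => htm (Nat.le_succ n)
  have h0 : ∀ n, (0 : ℝ) ≤ t n := fun n => (t n).2.1
  have hstrip : ∀ m n : ℕ, ∃ f : Y → G, ∀ z ∈ Icc (0 : ℝ) (t (n + 1)) ×ˢ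
      Icc (t m : ℝ) (t (m + 1)), V f (e z) := by
    intro m n
    induction n with
    | zero => simpa [ht0] using hcell 0 m
    | succ n ih =>
      obtain ⟨f, hf⟩ := ih
      obtain ⟨g, hg⟩ := hcell (n + 1) m
      exact hV.exists_merge_rect_fst hO hmap hS hinj (h0 _) (hle _) hf hg
  have hall : ∀ m : ℕ, ∃ f : Y → G, ∀ z ∈ Icc (0 : ℝ) 1 ×ˢ Icc (0 : ℝ) (t (m + 1)), V f (e z) := by
    intro m
    have h1 : ((t (N + 1) : unitInterval) : ℝ) = 1 := by rw [hN _ (Nat.le_succ N)]; rfl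
    induction m with
    | zero => simpa [ht0, h1] using hstrip 0 N
    | succ m ih =>
      obtain ⟨f, hf⟩ := ih
      obtain ⟨g, hg⟩ := hstrip (m + 1) N
      rw [h1] at hg
      exact hV.exists_merge_rect_snd hO hmap hS hinj (h0 _) (hle _) hf hg
  obtain ⟨f, hf⟩ := hall N
  rw [hN _ (Nat.le_succ N)] at hf
  exact ⟨f, hf⟩

theorem exists_on_closedBall (hV : IsTorsorSheaf S O V) (hO : O ⊆ S)
    (hmap : ∀ z, map e (𝓝 z) = 𝓝[S] (e z)) (hS : ∀ z, e z ∈ S) (hinj : e.Injective) {r : ℝ}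
    (hr : 0 < r) : ∃ f, ∀ z ∈ Metric.closedBall (0 : ℝ × ℝ) r, V f (e z) := by
  -- The ball of the sup norm on `ℝ × ℝ` is a square; this affine map takes `[0, 1]` to `[-r, r]`.
  let A : ℝ ≃ₜ ℝ := (Homeomorph.mulLeft₀ (2 * r) (by positivity)).trans (Homeomorph.addRight (-r))
  have hA : ∀ x, A x = 2 * r * x + -r := fun x => rfl
  obtain ⟨f, hf⟩ := hV.exists_on_unitSquare (e := e ∘ A.prodCongr A) hO (fun z => by
      rw [← Filter.map_map, Homeomorph.map_nhds_eq, hmap]; rfl) (fun z => hS _)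
      (hinj.comp (A.prodCongr A).injective)
  refine ⟨f, fun z hz => ?_⟩
  have h := hf ((A.prodCongr A).symm z) ?_
  · simpa only [Function.comp_apply, Homeomorph.apply_symm_apply] using h
  · obtain ⟨w, rfl⟩ := (A.prodCongr A).surjective z
    rw [mem_closedBall_zero_iff, Prod.norm_def, max_le_iff] at hz
    have h1 : |2 * r * w.1 + -r| ≤ r := hz.1
    have h2 : |2 * r * w.2 + -r| ≤ r := hz.2
    rw [abs_le] at h1 h2
    rw [Homeomorph.symm_apply_apply]
    refine ⟨⟨?_, ?_⟩, ⟨?_, ?_⟩⟩ <;> nlinarith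

/-- The constant `1` is already a section off the open square, so a section on the closed square is
merged with it along the boundary, which is connected because it is a sphere in a space of dimension
greater than one. -/
theorem exists_global [T2Space Y] (hV : IsTorsorSheaf S O V) (hO : O ⊆ S)
    (hmap : ∀ z, map e (𝓝 z) = 𝓝[S] (e z)) (hS : ∀ z, e z ∈ S) (hinj : e.Injective) {r : ℝ}
    (hr : 0 < r) (hone : ∀ x ∈ S, x ∉ e '' Metric.ball 0 r → V 1 x) : ∃ f, ∀ x ∈ S, V f x := by
  obtain ⟨f, hf⟩ := hV.exists_on_closedBall hO hmap hS hinj hr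
  have hcont : Continuous e := continuous_iff_continuousAt.2 fun z =>
    (hmap z).le.trans nhdsWithin_le_nhds
  have hrank : 1 < Module.rank ℝ (ℝ × ℝ) := by
    rw [rank_prod', Module.rank_self, one_add_one_eq_two]
    exact Cardinal.one_lt_two
  have hclosed : IsClosed (e '' Metric.closedBall 0 r) :=
    ((isCompact_closedBall _ _).image hcont).isClosed
  have hC' : IsPreconnected (e '' Metric.sphere 0 r) :=
    (isPreconnected_sphere hrank 0 r).image _ hcont.continuousOn
  have hnot : ∀ z ∈ Metric.sphere (0 : ℝ × ℝ) r, e z ∉ e '' Metric.ball 0 r := by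
    rintro z hz ⟨w, hw, he⟩
    rw [hinj he] at hw
    simp only [mem_sphere_iff_norm, sub_zero, Metric.mem_ball, dist_zero_right] at hz hw
    linarith
  obtain ⟨f', -, h⟩ := hV.exists_merge hO (A := e '' Metric.closedBall 0 r) (K := S) (g := 1)
    (by rintro _ ⟨z, -, rfl⟩; exact hS z) hC' subset_rfl (f := f)
    (by rintro _ ⟨z, hz, rfl⟩; exact hf z (Metric.sphere_subset_closedBall hz))
    (by rintro _ ⟨z, hz, rfl⟩; exact hone _ (hS _) (hnot z hz))
    (by
      intro x hx
      by_cases hxA : x ∈ e '' Metric.closedBall 0 r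
      · obtain ⟨z, hz, rfl⟩ := hxA
        rcases (mem_closedBall_zero_iff.1 hz).lt_or_eq with h | h
        · refine Or.inl ⟨?_, hf z hz⟩
          rw [← hmap]
          refine image_mem_map (mem_of_superset (Metric.isOpen_ball.mem_nhds ?_)
            Metric.ball_subset_closedBall)
          simpa using h
        · exact Or.inr (Or.inr ⟨z, by simpa using h, rfl⟩)
      · exact Or.inr (Or.inl ⟨nhdsWithin_le_nhds (hclosed.isOpen_compl.mem_nhds hxA),
          hone x hx fun ⟨z, hz, he⟩ => hxA ⟨z, Metric.ball_subset_closedBall hz, he⟩⟩))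
  exact ⟨f', h⟩

end IsTorsorSheaf

end LinkDiag

/-! ### Vector algebra and the geometry of the two surfaces -/

namespace LinkDiag

/-- The scalar product of vectors of `E3`, in coordinates. -/
def dot3 (u v : E3) : ℝ := u 0 * v 0 + u 1 * v 1 + u 2 * v 2

/-- The vector product of vectors of `E3`. -/
def cross3 (u v : E3) : E3 :=
  !₂[u 1 * v 2 - u 2 * v 1, u 2 * v 0 - u 0 * v 2, u 0 * v 1 - u 1 * v 0]

/-- The determinant of three vectors of `E3`. -/
def det3 (u v w : E3) : ℝ :=
  u 0 * (v 1 * w 2 - v 2 * w 1) - u 1 * (v 0 * w 2 - v 2 * w 0) + u 2 * (v 0 * w 1 - v 1 * w 0)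

theorem dot3_self (u : E3) : dot3 u u = ‖u‖ ^ 2 := by
  rw [EuclideanSpace.norm_sq_eq, Fin.sum_univ_three, dot3]
  simp [sq]

theorem dot3_eq_inner (u v : E3) : dot3 u v = inner ℝ u v := by
  simp only [PiLp.inner_apply, Fin.sum_univ_three, dot3]
  simp [mul_comm]

theorem dot3_cross3_left (u v : E3) : dot3 u (cross3 u v) = 0 := by
  simp [dot3, cross3]; ring

theorem det3_cross3 (n a : E3) :
    det3 n a (cross3 n a) = dot3 n n * dot3 a a - dot3 n a ^ 2 := by
  simp [dot3, cross3, det3]; ring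

theorem det3_cross3_swap (n b : E3) :
    det3 n (cross3 n b) b = -(dot3 n n * dot3 b b - dot3 n b ^ 2) := by
  simp [dot3, cross3, det3]; ring

theorem ext3 {u v : E3} (h0 : u 0 = v 0) (h1 : u 1 = v 1) (h2 : u 2 = v 2) : u = v := by
  ext i
  fin_cases i <;> assumption

/-- Cramer's rule for `u` in terms of `n`, `a`, `b`, with the denominator cleared. -/
theorem det3_smul_eq (n a b u : E3) :
    det3 n a b • u = det3 u a b • n + det3 n u b • a + det3 n a u • b := by
  apply ext3 <;> simp [det3] <;> ring

theorem continuous_cross3 : Continuous fun z : E3 × E3 => cross3 z.1 z.2 := by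
  unfold cross3
  refine (PiLp.continuous_toLp 2 _).comp (continuous_pi fun i => ?_)
  fin_cases i <;> simp <;> fun_prop

/-- The projection of space onto the plane of `a` and `b` along `n`, in the basis `a`, `b`. -/
def planeCoord (n a b : E3) : E3 →L[ℝ] ℝ × ℝ :=
  LinearMap.toContinuousLinearMap
    { toFun := fun u => (det3 n u b / det3 n a b, det3 n a u / det3 n a b)
      map_add' := fun u v => by
        ext <;> simp only [det3, PiLp.add_apply, Prod.fst_add, Prod.snd_add] <;> ring
      map_smul' := fun c u => by
        ext <;> simp only [det3, PiLp.smul_apply, Prod.smul_fst, Prod.smul_snd, smul_eq_mul,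
          RingHom.id_apply] <;> ring }

theorem planeCoord_apply (n a b u : E3) :
    planeCoord n a b u = (det3 n u b / det3 n a b, det3 n a u / det3 n a b) := rfl

theorem planeCoord_comb {n a b : E3} (h : det3 n a b ≠ 0) (s t : ℝ) :
    planeCoord n a b (s • a + t • b) = (s, t) := by
  rw [planeCoord_apply]
  ext
  · rw [div_eq_iff h]; simp [det3]; ring
  · rw [div_eq_iff h]; simp [det3]; ring

theorem exists_smul_of_planeCoord_eq_zero {n a b u : E3} (h : det3 n a b ≠ 0)
    (hu : planeCoord n a b u = 0) : ∃ c : ℝ, u = c • n := by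
  rw [planeCoord_apply, Prod.mk_eq_zero, div_eq_zero_iff, div_eq_zero_iff] at hu
  have h1 := hu.1.resolve_right h
  have h2 := hu.2.resolve_right h
  have := det3_smul_eq n a b u
  rw [h1, h2, zero_smul, zero_smul, add_zero, add_zero] at this
  refine ⟨(det3 n a b)⁻¹ * det3 u a b, ?_⟩
  rw [mul_smul, ← this, inv_smul_smul₀ h]

namespace Surface

/-- A retraction of a neighbourhood of the surface onto the surface. -/
def retract : Surface → E3 → E3
  | .plane, y => y - y 2 • !₂[0, 0, 1]
  | .sphere, y => (√(‖y‖ ^ 2))⁻¹ • y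

theorem retract_of_mem {S : Surface} {y : E3} (hy : y ∈ S.carrier) : S.retract y = y := by
  cases S
  · have : y 2 = 0 := hy
    simp [retract, this]
  · have : ‖y‖ = 1 := by simpa [carrier] using hy
    simp [retract, this]

theorem eventually_retract_mem {S : Surface} {x : E3} (hx : x ∈ S.carrier) :
    ∀ᶠ y in 𝓝 x, S.retract y ∈ S.carrier := by
  cases S
  · exact Eventually.of_forall fun y => by simp [retract, carrier]
  · have hx1 : ‖x‖ = 1 := by simpa [carrier] using hx
    have hx : x ≠ 0 := by rintro rfl; simp at hx1
    filter_upwards [isOpen_ne.mem_nhds hx] with y hy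
    have : ‖y‖ ≠ 0 := by simpa using hy
    simp [retract, carrier, norm_smul, this]

theorem dot3_normal_self {S : Surface} {x : E3} (hx : x ∈ S.carrier) :
    dot3 (S.normal x) (S.normal x) = 1 := by
  cases S
  · simp [normal, dot3]
  · have hx1 : ‖x‖ = 1 := by simpa [carrier] using hx
    simp [normal, dot3_self, hx1]

theorem det3_cross3_normal_pos {S : Surface} {x a : E3} (hx : x ∈ S.carrier)
    (ha : dot3 (S.normal x) a = 0) (ha0 : a ≠ 0) :
    0 < det3 (S.normal x) a (cross3 (S.normal x) a) := by
  have : 0 < ‖a‖ := by simpa using ha0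
  rw [det3_cross3, dot3_normal_self hx, ha, dot3_self]
  nlinarith [sq_nonneg ‖a‖, mul_pos this this]

/-- The derivative is the orthogonal projection to the tangent plane, so the retraction does not
change tangent velocities to first order. -/
theorem exists_hasStrictFDerivAt_retract {S : Surface} {x : E3} (hx : x ∈ S.carrier) :
    ∃ R' : E3 →L[ℝ] E3, HasStrictFDerivAt S.retract R' x ∧
      ∀ u, R' u = u - dot3 (S.normal x) u • S.normal x := by
  cases S
  · refine ⟨ContinuousLinearMap.id ℝ E3 -
      (EuclideanSpace.proj (𝕜 := ℝ) (2 : Fin 3)).smulRight (!₂[0, 0, 1] : E3), ?_, fun u => ?_⟩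
    · exact (ContinuousLinearMap.hasStrictFDerivAt _ : HasStrictFDerivAt
        (⇑(ContinuousLinearMap.id ℝ E3 -
        (EuclideanSpace.proj (𝕜 := ℝ) (2 : Fin 3)).smulRight (!₂[0, 0, 1] : E3))) _ x)
    · simp [normal, dot3]
  · have hx1 : ‖x‖ = 1 := by simpa [carrier] using hx
    -- Writing the norm as the root of its square reduces its strict derivative to that of a
    -- quadratic function.
    have h1 : HasStrictFDerivAt (fun y : E3 => √(‖y‖ ^ 2)) _ x :=
      (hasStrictFDerivAt_norm_sq x).sqrt (by simp [hx1])
    have h2 := ((hasStrictDerivAt_inv (x := √(‖x‖ ^ 2)) (by simp [hx1])).comp_hasStrictFDerivAt x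
      h1).smul (hasStrictFDerivAt_id x)
    refine ⟨_, h2, fun u => ?_⟩
    simp [hx1, normal, dot3_eq_inner, sub_eq_add_neg]

/-- Points with the same projection differ by `c • n`. On the sphere either `c = 0` or `c = -2⟪y',
x⟫`; the latter reflects `y'` to the opposite hemisphere and is excluded near `x`. -/
theorem exists_injOn_planeCoord {S : Surface} {x a b : E3} (hx : x ∈ S.carrier)
    (h : det3 (S.normal x) a b ≠ 0) :
    ∃ U ∈ 𝓝 x, InjOn (planeCoord (S.normal x) a b) (S.carrier ∩ U) := by
  cases S
  · refine ⟨univ, univ_mem, fun y hy y' hy' hyy => ?_⟩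
    obtain ⟨c, hc⟩ := exists_smul_of_planeCoord_eq_zero (u := y - y') h
      (by rw [map_sub, hyy, sub_self])
    have h1 : y 2 = 0 := hy.1
    have h2 : y' 2 = 0 := hy'.1
    have h3 := congrArg (fun z : E3 => z 2) hc
    simp [h1, h2, normal] at h3
    rw [← h3, zero_smul, sub_eq_zero] at hc
    exact hc
  · have hx1 : ‖x‖ = 1 := by simpa [carrier] using hx
    refine ⟨{y | 0 < inner ℝ y x}, (isOpen_lt continuous_const (by fun_prop)).mem_nhds
      (by simp [hx1]), fun y hy y' hy' hyy => ?_⟩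
    obtain ⟨c, hc⟩ := exists_smul_of_planeCoord_eq_zero (u := y - y') h
      (by rw [map_sub, hyy, sub_self])
    have h1 : ‖y‖ = 1 := by simpa [carrier] using hy.1
    have h2 : ‖y'‖ = 1 := by simpa [carrier] using hy'.1
    have h3 : 0 < inner ℝ y x := hy.2
    have h4 : 0 < inner ℝ y' x := hy'.2
    have hc' : y = y' + c • x := by rw [← sub_eq_iff_eq_add']; exact hc
    have h5 : ‖y‖ ^ 2 = 1 + 2 * (c * inner ℝ y' x) + c ^ 2 := by
      rw [hc', norm_add_sq_real, h2, inner_smul_right, norm_smul, hx1]; simp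
    have h6 : inner ℝ y x = inner ℝ y' x + c := by
      rw [hc', inner_add_left, inner_smul_left, real_inner_self_eq_norm_sq, hx1]; simp
    have h7 : c * (2 * inner ℝ y' x + c) = 0 := by rw [h1] at h5; linarith
    rcases mul_eq_zero.1 h7 with h8 | h8
    · rw [hc', h8, zero_smul, add_zero]
    · linarith

theorem dot3_normal_of_hasDerivAt {S : Surface} {γ : ℝ → E3} {v : E3} {t : ℝ}
    (hγ : ∀ s, γ s ∈ S.carrier) (hv : HasDerivAt γ v t) : dot3 (S.normal (γ t)) v = 0 := by
  cases S
  · have h1 : HasDerivAt (fun s => γ s 2) (v 2) t :=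
      (EuclideanSpace.proj (𝕜 := ℝ) (2 : Fin 3)).hasFDerivAt.comp_hasDerivAt t hv
    have h2 : (fun s => γ s 2) = fun _ => 0 := funext fun s => hγ s
    rw [h2] at h1
    simp [dot3, normal, h1.unique (hasDerivAt_const t 0)]
  · have h1 := hv.norm_sq
    have h2 : (fun s => ‖γ s‖ ^ 2) = fun _ => 1 := funext fun s => by
      have : ‖γ s‖ = 1 := by simpa [carrier] using hγ s
      simp [this]
    rw [h2] at h1
    have := h1.unique (hasDerivAt_const t 1)
    rw [normal, dot3_eq_inner]
    linarith

end Surface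

/-! ### Charts in which two transverse curves are the axes -/

/-- Local coordinates `ζ` of the surface near `x`, with inverse `H`, in which two curves through
`x` become the coordinate axes. -/
structure CrossChart (S : Surface) (x a b : E3) (γ₁ γ₂ : ℝ → E3) where
  H : ℝ × ℝ → E3
  ζ : E3 → ℝ × ℝ
  H_fst : ∀ s, H (s, 0) = S.retract (γ₁ s)
  H_snd : ∀ t, H (0, t) = S.retract (γ₂ t)
  H_zero : H 0 = x
  ζ_self : ζ x = 0
  hasStrictFDerivAt_H : HasStrictFDerivAt H ((ContinuousLinearMap.fst ℝ ℝ ℝ).smulRight a +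
    (ContinuousLinearMap.snd ℝ ℝ ℝ).smulRight b) 0
  hasStrictFDerivAt_ζ : HasStrictFDerivAt ζ (planeCoord (S.normal x) a b) x
  eventually_mem : ∀ᶠ z in 𝓝 0, H z ∈ S.carrier
  eventually_left : ∀ᶠ z in 𝓝 0, ζ (H z) = z
  eventually_right : ∀ᶠ y in 𝓝[S.carrier] x, H (ζ y) = y

/-- Add the displacements along the two curves and retract to the surface: this is `H`. Projected to
the plane of `a` and `b`, it has the identity as derivative at `0`, so the inverse function theorem
applies; `ζ` is the projection followed by the local inverse. -/
theorem nonempty_crossChart {S : Surface} {x a b : E3} {γ₁ γ₂ : ℝ → E3} (hx : x ∈ S.carrier)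
    (h₁ : HasStrictDerivAt γ₁ a 0) (h₂ : HasStrictDerivAt γ₂ b 0) (hx₁ : γ₁ 0 = x)
    (hx₂ : γ₂ 0 = x) (ha : dot3 (S.normal x) a = 0) (hb : dot3 (S.normal x) b = 0)
    (hdet : det3 (S.normal x) a b ≠ 0) : Nonempty (CrossChart S x a b γ₁ γ₂) := by
  obtain ⟨R', hR, hR'⟩ := S.exists_hasStrictFDerivAt_retract hx
  set P := planeCoord (S.normal x) a b with hP
  let H : ℝ × ℝ → E3 := fun z => S.retract (γ₁ z.1 + (γ₂ z.2 - x))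
  have hz0 : H 0 = x := by
    simp only [H, Prod.fst_zero, Prod.snd_zero, hx₁, hx₂, sub_self, add_zero]
    exact Surface.retract_of_mem hx
  have hH : HasStrictFDerivAt H ((ContinuousLinearMap.fst ℝ ℝ ℝ).smulRight a +
      (ContinuousLinearMap.snd ℝ ℝ ℝ).smulRight b) 0 := by
    have e1 : HasStrictFDerivAt (fun z : ℝ × ℝ => γ₁ z.1) _ 0 :=
      HasStrictFDerivAt.comp (g := γ₁) (f := Prod.fst) (0 : ℝ × ℝ) h₁.hasStrictFDerivAt
        hasStrictFDerivAt_fst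
    have e2 : HasStrictFDerivAt (fun z : ℝ × ℝ => γ₂ z.2) _ 0 :=
      HasStrictFDerivAt.comp (g := γ₂) (f := Prod.snd) (0 : ℝ × ℝ) h₂.hasStrictFDerivAt
        hasStrictFDerivAt_snd
    have e3 := e1.add (e2.sub_const x)
    have e4 : (fun z : ℝ × ℝ => γ₁ z.1 + (γ₂ z.2 - x)) 0 = x := by simp [hx₁, hx₂]
    have e5 := HasStrictFDerivAt.comp (g := S.retract) (0 : ℝ × ℝ) (e4.symm ▸ hR) e3
    refine e5.congr_fderiv ?_
    refine ContinuousLinearMap.ext fun z => ?_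
    have e6 : dot3 (S.normal x) (z.1 • a + z.2 • b) = 0 := by
      have : dot3 (S.normal x) (z.1 • a + z.2 • b) =
        z.1 * dot3 (S.normal x) a + z.2 * dot3 (S.normal x) b := by simp [dot3]; ring
      rw [this, ha, hb]; ring
    have e7 := hR' (z.1 • a + z.2 • b)
    rw [e6, zero_smul, sub_zero] at e7
    simpa using e7
  have hPH : HasStrictFDerivAt (P ∘ H) (ContinuousLinearEquiv.refl ℝ (ℝ × ℝ) :
      ℝ × ℝ →L[ℝ] ℝ × ℝ) 0 := by
    refine (HasStrictFDerivAt.comp (0 : ℝ × ℝ) P.hasStrictFDerivAt hH).congr_fderiv ?_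
    refine ContinuousLinearMap.ext fun z => ?_
    exact planeCoord_comb hdet z.1 z.2
  let Q := hPH.localInverse (P ∘ H) _ 0
  have hQ : HasStrictFDerivAt Q ((ContinuousLinearEquiv.refl ℝ (ℝ × ℝ)).symm :
      ℝ × ℝ →L[ℝ] ℝ × ℝ) ((P ∘ H) 0) :=
    hPH.to_localInverse
  rw [Function.comp_apply, hz0] at hQ
  have hleft : ∀ᶠ z in 𝓝 0, Q (P (H z)) = z := hPH.eventually_left_inverse
  have hright : ∀ᶠ w in 𝓝 (P x), P (H (Q w)) = w := by
    have := hPH.eventually_right_inverse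
    rwa [Function.comp_apply, hz0] at this
  have hζ : HasStrictFDerivAt (Q ∘ P) P x :=
    (HasStrictFDerivAt.comp x hQ P.hasStrictFDerivAt).congr_fderiv
      (ContinuousLinearMap.ext fun z => rfl)
  have hζ0 : Q (P x) = 0 := by
    have := hleft.self_of_nhds
    rwa [hz0] at this
  have hmem : ∀ᶠ z in 𝓝 0, H z ∈ S.carrier := by
    have e1 : Tendsto (fun z : ℝ × ℝ => γ₁ z.1 + (γ₂ z.2 - x)) (𝓝 0) (𝓝 x) := by
      have : Tendsto (fun z : ℝ × ℝ => γ₁ z.1 + (γ₂ z.2 - x)) (𝓝 0) (𝓝 (γ₁ 0 + (γ₂ 0 - x))) :=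
        (h₁.hasDerivAt.continuousAt.tendsto.comp (continuous_fst.tendsto' (0 : ℝ × ℝ) 0 rfl)).add
          ((h₂.hasDerivAt.continuousAt.tendsto.comp
            (continuous_snd.tendsto' (0 : ℝ × ℝ) 0 rfl)).sub_const x)
      simpa [hx₁, hx₂] using this
    exact e1.eventually (Surface.eventually_retract_mem hx)
  obtain ⟨U, hU, hinj⟩ := Surface.exists_injOn_planeCoord hx hdet
  have hζt : Tendsto (Q ∘ P) (𝓝 x) (𝓝 0) := by
    have := hζ.continuousAt.tendsto
    rwa [Function.comp_apply, hζ0] at this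
  have hHt : Tendsto H (𝓝 0) (𝓝 x) := by
    have := hH.continuousAt.tendsto
    rwa [hz0] at this
  refine ⟨⟨H, Q ∘ P, fun s => ?_, fun t => ?_, hz0, hζ0, hH, hζ, hmem, hleft, ?_⟩⟩
  · simp only [H, hx₂, sub_self, add_zero]
  · simp only [H, hx₁, add_sub_cancel]
  -- `H (ζ y)` and `y` lie on the surface and have the same projection, so local injectivity of the
  -- projection identifies them.
  · rw [eventually_nhdsWithin_iff]
    filter_upwards [(P.continuous.tendsto x).eventually hright, hζt.eventually hmem,
      (hHt.comp hζt).eventually hU, hU] with y hy1 hy2 hy3 hy4 hyS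
    exact hinj ⟨hy2, hy3⟩ ⟨hyS, hy4⟩ hy1

/-- A function with a strict derivative is continuous on a neighbourhood. -/
theorem eventually_continuousAt_of_hasStrictFDerivAt {E F : Type*} [NormedAddCommGroup E]
    [NormedSpace ℝ E] [NormedAddCommGroup F] [NormedSpace ℝ F] {f : E → F} {f' : E →L[ℝ] F}
    {x : E} (hf : HasStrictFDerivAt f f' x) : ∀ᶠ y in 𝓝 x, ContinuousAt f y := by
  obtain ⟨K, s, hs, h⟩ := hf.exists_lipschitzOnWith
  filter_upwards [eventually_mem_nhds_iff.2 hs] with y hy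
  exact h.continuousOn.continuousAt hy

/-- If `g` vanishes along the curve `γ` and increases in the direction of `w`, then it is positive
on one side of the curve and negative on the other. -/
theorem eventually_sign_of_hasStrictFDerivAt {E : Type*} [NormedAddCommGroup E]
    [NormedSpace ℝ E] {g : E → ℝ} {g' : E →L[ℝ] ℝ} {γ w : ℝ → E} {x : E}
    (hg : HasStrictFDerivAt g g' x) (hγ : ContinuousAt γ 0) (hw : ContinuousAt w 0)
    (hx : γ 0 = x) (h0 : ∀ᶠ s in 𝓝 0, g (γ s) = 0) (hpos : 0 < g' (w 0)) :
    ∀ᶠ z : ℝ × ℝ in 𝓝 0, (0 < z.2 → 0 < g (γ z.1 + z.2 • w z.1)) ∧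
      (z.2 < 0 → g (γ z.1 + z.2 • w z.1) < 0) := by
  have hf : Tendsto (fun z : ℝ × ℝ => z.1) (𝓝 0) (𝓝 0) := continuous_fst.tendsto' _ _ rfl
  have hs : Tendsto (fun z : ℝ × ℝ => z.2) (𝓝 0) (𝓝 0) := continuous_snd.tendsto' _ _ rfl
  have h1 : Tendsto (fun z : ℝ × ℝ => γ z.1) (𝓝 0) (𝓝 x) := hx ▸ hγ.tendsto.comp hf
  have h2 : Tendsto (fun z : ℝ × ℝ => w z.1) (𝓝 0) (𝓝 (w 0)) := hw.tendsto.comp hf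
  have h3 : Tendsto (fun z : ℝ × ℝ => γ z.1 + z.2 • w z.1) (𝓝 0) (𝓝 x) := by
    simpa using h1.add (hs.smul h2)
  set c := g' (w 0) with hc
  have h4 : ∀ᶠ z : ℝ × ℝ in 𝓝 0, c / 2 < g' (w z.1) :=
    ((g'.continuous.tendsto _).comp h2).eventually (lt_mem_nhds (by linarith))
  have h5 : ∀ᶠ z : ℝ × ℝ in 𝓝 0, ‖w z.1‖ < ‖w 0‖ + 1 :=
    h2.norm.eventually (gt_mem_nhds (by linarith))
  set K := ‖w 0‖ + 1 with hK
  have hKpos : 0 < K := by positivity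
  -- With this constant the error in the linear approximation is at most `|z.2| * c / 4`, while the
  -- linear term exceeds `|z.2| * c / 2` when `z.2 ≠ 0`.
  have h6 := (h3.prodMk_nhds h1).eventually
    (hg.isLittleO.def (c := c / (4 * K)) (by positivity))
  filter_upwards [h4, h5, h6, hf.eventually h0] with z h4 h5 h6 h7
  simp only [h7, add_sub_cancel_left, map_smul, norm_smul, smul_eq_mul, sub_zero,
    Real.norm_eq_abs] at h6
  have h8 : c / (4 * K) * (|z.2| * ‖w z.1‖) ≤ |z.2| * (c / 4) := by
    have : c / (4 * K) * ‖w z.1‖ ≤ c / (4 * K) * K := by gcongr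
    have e : c / (4 * K) * K = c / 4 := by field_simp
    rw [e] at this
    calc _ = |z.2| * (c / (4 * K) * ‖w z.1‖) := by ring
      _ ≤ _ := by gcongr
  have h9 := abs_le.1 (h6.trans h8)
  constructor
  · intro hz
    rw [abs_of_pos hz] at h9
    nlinarith
  · intro hz
    rw [abs_of_neg hz] at h9
    nlinarith

end LinkDiag

/-! ### Moving along the circles; transversals to the diagram -/

namespace LinkDiag

/-- The point reached from `p` after time `s`. -/
def adv {n : ℕ} (p : Circles n) (s : ℝ) : Circles n := (p.1, p.2 + (s : UnitAddCircle))

variable {n : ℕ}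

@[simp] theorem adv_zero (p : Circles n) : adv p 0 = p := by simp [adv]

theorem adv_adv (p : Circles n) (s t : ℝ) : adv (adv p s) t = adv p (s + t) := by
  simp [adv, add_assoc]

theorem continuous_adv (p : Circles n) : Continuous (adv p) :=
  continuous_const.prodMk (continuous_const.add (AddCircle.continuous_mk' 1))

theorem map_adv_nhds (p : Circles n) (s : ℝ) : map (adv p) (𝓝 s) = 𝓝 (adv p s) := by
  refine le_antisymm (continuous_adv p).continuousAt ?_
  have h1 : IsOpenMap (fun s : ℝ => p.2 + (s : UnitAddCircle)) :=
    (isOpenMap_add_left p.2).comp QuotientAddGroup.isOpenMap_coe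
  have h2 : IsOpenMap (adv p) := by
    intro U hU
    have : adv p '' U = {p.1} ×ˢ ((fun s : ℝ => p.2 + (s : UnitAddCircle)) '' U) := by
      ext ⟨a, b⟩
      simp only [adv, mem_image, Prod.mk.injEq, mem_prod, mem_singleton_iff]
      grind
    rw [this]
    exact (isOpen_discrete _).prod (h1 U hU)
  exact h2.nhds_le s

theorem eventually_adv {p : Circles n} {Q : Circles n → Prop} :
    (∀ᶠ s in 𝓝 (0 : ℝ), Q (adv p s)) ↔ ∀ᶠ r in 𝓝 p, Q r := by
  have := map_adv_nhds p 0
  rw [adv_zero] at this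
  rw [← this, eventually_map]

theorem eventually_adv_ne (p : Circles n) : ∀ᶠ s in 𝓝[≠] (0 : ℝ), adv p s ≠ p := by
  rw [eventually_nhdsWithin_iff]
  filter_upwards [Ioo_mem_nhds (show (-1 : ℝ) < 0 by norm_num) one_pos] with s hs hs0 h
  have h1 : (s : UnitAddCircle) = 0 := by simpa [adv, Prod.ext_iff] using h
  obtain ⟨k, hk⟩ := AddCircle.coe_eq_zero_iff (1 : ℝ) |>.1 h1
  simp only [zsmul_eq_mul, mul_one] at hk
  rw [← hk] at hs
  have h2 : -1 < k := by exact_mod_cast hs.1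
  have h3 : k < 1 := by exact_mod_cast hs.2
  have h4 : k = 0 := by lia
  exact hs0 (by rw [← hk, h4]; simp)

end LinkDiag

namespace OrientedLinkDiagram

open LinkDiag

variable {S : LinkDiag.Surface} (D : OrientedLinkDiagram S)

theorem contDiff_curve_adv (p : Circles D.n) : ContDiff ℝ 1 fun s => D.curve (adv p s) := by
  obtain ⟨i, c⟩ := p
  induction c using QuotientAddGroup.induction_on with
  | H x =>
    have := (D.contDiff i).comp (contDiff_const.add contDiff_id : ContDiff ℝ 1 fun s : ℝ => x + s)
    exact this

theorem velocity_adv (p : Circles D.n) (s : ℝ) :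
    velocity D.curve (adv p s) = deriv (fun t => D.curve (adv p t)) s := by
  have : (fun t => D.curve (adv (adv p s) t)) = fun t => (fun t => D.curve (adv p t)) (s + t) :=
    funext fun t => by rw [adv_adv]
  change deriv (fun t => D.curve (adv (adv p s) t)) 0 = _
  rw [this]
  exact (deriv_comp_const_add (f := fun t => D.curve (adv p t)) s 0).trans (by rw [add_zero])

theorem hasStrictDerivAt_curve (p : Circles D.n) :
    HasStrictDerivAt (fun s => D.curve (adv p s)) (velocity D.curve p) 0 := by
  have := (D.contDiff_curve_adv p).contDiffAt.hasStrictDerivAt (x := 0) one_ne_zero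
  rwa [← velocity_adv, adv_zero] at this

theorem continuous_velocity_adv (p : Circles D.n) :
    Continuous fun s => velocity D.curve (adv p s) := by
  simp_rw [velocity_adv]
  exact (D.contDiff_curve_adv p).continuous_deriv le_rfl

theorem continuous_curve : Continuous D.curve := by
  rw [continuous_iff_continuousAt]
  intro p
  have h := (D.contDiff_curve_adv p).continuous.tendsto 0
  have := map_adv_nhds p 0
  rw [adv_zero] at this h
  rw [ContinuousAt, ← this, tendsto_map'_iff]
  exact h

theorem dot3_normal_velocity (p : Circles D.n) :
    dot3 (S.normal (D.curve p)) (velocity D.curve p) = 0 := by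
  have := Surface.dot3_normal_of_hasDerivAt (fun s => D.curve_mem (adv p s))
    (D.hasStrictDerivAt_curve p).hasDerivAt
  rwa [adv_zero] at this

theorem isClosed_shadow : IsClosed D.shadow := (isCompact_range D.continuous_curve).isClosed

/-- Compactness of the circles: the image of the closed set of points with no neighbourhood on which
`Q` holds is closed and misses `x`. -/
theorem eventually_fiber {x : E3} {Q : Circles D.n → Prop}
    (h : ∀ p, D.curve p = x → ∀ᶠ r in 𝓝 p, Q r) :
    ∀ᶠ y in 𝓝 x, ∀ r, D.curve r = y → Q r := by
  have h1 : IsClosed (D.curve '' (interior {r | Q r})ᶜ) :=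
    (isOpen_interior.isClosed_compl.isCompact.image D.continuous_curve).isClosed
  have h2 : x ∉ D.curve '' (interior {r | Q r})ᶜ := by
    rintro ⟨p, hp, hpx⟩
    exact hp (mem_interior_iff_mem_nhds.2 (h p hpx))
  filter_upwards [h1.isOpen_compl.mem_nhds h2] with y hy r hr
  by_contra hQ
  exact hy ⟨r, fun hr' => hQ (interior_subset hr'), hr⟩

/-- The point `p` is not at a crossing. -/
def Regular (p : Circles D.n) : Prop := ∀ q, D.curve q = D.curve p → q = p

variable {D}

theorem Regular.notMem_under {p : Circles D.n} (h : D.Regular p) : p ∉ D.under := fun hp => by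
  obtain ⟨q, hq, hqp⟩ := D.under_double p hp
  exact hq (h q hqp)

variable (D)

theorem eventually_regular (p : Circles D.n) : ∀ᶠ r in 𝓝 p, r ≠ p → D.Regular r := by
  have h1 : ({r | ∃ q, q ≠ r ∧ D.curve q = D.curve r} \ {p}).Finite := D.finite_double.sdiff
  filter_upwards [h1.isClosed.isOpen_compl.mem_nhds (fun h => h.2 rfl)] with r hr hrp q hq
  by_contra hqr
  exact hr ⟨⟨q, hqr, hq⟩, hrp⟩

theorem eventually_adv_regular (p : Circles D.n) : ∀ᶠ s in 𝓝[≠] (0 : ℝ), D.Regular (adv p s) := by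
  filter_upwards [eventually_adv_ne p,
    nhdsWithin_le_nhds (eventually_adv.2 (D.eventually_regular p))] with s h1 h2
  exact h2 h1

theorem eventually_notMem_under {p : Circles D.n} (h : p ∉ D.under) :
    ∀ᶠ r in 𝓝 p, r ∉ D.under := by
  filter_upwards [D.eventually_regular p] with r hr
  by_cases h' : r = p
  · exact h' ▸ h
  · exact (hr h').notMem_under

/-- The transversal to the link diagram at `p`, which runs from the right to the left. -/
def collar (p : Circles D.n) (t : ℝ) : E3 :=
  S.retract (D.curve p + t • cross3 (S.normal (D.curve p)) (velocity D.curve p))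

theorem collar_zero (p : Circles D.n) : D.collar p 0 = D.curve p := by
  simp [collar, Surface.retract_of_mem (D.curve_mem p)]

theorem continuous_normal_curve (p : Circles D.n) :
    Continuous fun s => S.normal (D.curve (adv p s)) := by
  have := (D.contDiff_curve_adv p).continuous
  cases S
  · exact continuous_const
  · exact this

theorem continuous_cross3_curve (p : Circles D.n) : Continuous fun s =>
    cross3 (S.normal (D.curve (adv p s))) (velocity D.curve (adv p s)) :=
  continuous_cross3.comp ((D.continuous_normal_curve p).prodMk (D.continuous_velocity_adv p))

theorem tendsto_collar (p : Circles D.n) : Tendsto (fun z : ℝ × ℝ => D.collar (adv p z.1) z.2)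
    (𝓝 0) (𝓝[S.carrier] D.curve p) := by
  have h0 : Tendsto (fun z : ℝ × ℝ => D.curve (adv p z.1) + z.2 •
      cross3 (S.normal (D.curve (adv p z.1))) (velocity D.curve (adv p z.1)))
      (𝓝 0) (𝓝 (D.curve p)) := by
    have h1 := (D.contDiff_curve_adv p).continuous
    have h2 := D.continuous_cross3_curve p
    refine Continuous.tendsto' ?_ _ _ (by simp)
    exact (h1.comp continuous_fst).add (continuous_snd.smul (h2.comp continuous_fst))
  obtain ⟨R', hR, -⟩ := S.exists_hasStrictFDerivAt_retract (D.curve_mem p)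
  refine tendsto_nhdsWithin_iff.2 ⟨?_, h0.eventually (Surface.eventually_retract_mem
    (D.curve_mem p))⟩
  have := hR.continuousAt.tendsto.comp h0
  rwa [Surface.retract_of_mem (D.curve_mem p)] at this

theorem tendsto_collar_zero (p : Circles D.n) :
    Tendsto (D.collar p) (𝓝 0) (𝓝[S.carrier] D.curve p) := by
  have := (D.tendsto_collar p).comp
    ((continuous_const.prodMk continuous_id).tendsto' (0 : ℝ) ((0, 0) : ℝ × ℝ) rfl)
  simpa [Function.comp_def] using this

/-- The function `l ∘ ζ`, composed with the retraction, vanishes along the strand and has nonzero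
derivative in the transversal direction. The estimate is uniform in the base point on the strand,
which permits reading off jumps at all points near `p`. -/
theorem eventually_sign_collar {p : Circles D.n} {a b : E3} {ζ : E3 → ℝ × ℝ}
    (hζ : HasStrictFDerivAt ζ (planeCoord (S.normal (D.curve p)) a b) (D.curve p))
    (l : ℝ × ℝ →L[ℝ] ℝ) (h0 : ∀ᶠ s in 𝓝 (0 : ℝ), l (ζ (D.curve (adv p s))) = 0)
    (hl : l (planeCoord (S.normal (D.curve p)) a b
      (cross3 (S.normal (D.curve p)) (velocity D.curve p))) ≠ 0) :
    ∀ᶠ z : ℝ × ℝ in 𝓝 0, SignType.sign (l (ζ (D.collar (adv p z.1) z.2))) =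
      SignType.sign z.2 * SignType.sign (l (planeCoord (S.normal (D.curve p)) a b
      (cross3 (S.normal (D.curve p)) (velocity D.curve p)))) := by
  set P := planeCoord (S.normal (D.curve p)) a b with hP
  set w := cross3 (S.normal (D.curve p)) (velocity D.curve p) with hw
  wlog hpos : 0 < l (P w) generalizing l
  · have := this (-l) (by simpa using h0) (by simpa using hl)
      (by simpa using lt_of_le_of_ne (not_lt.1 hpos) hl)
    filter_upwards [this] with z hz
    simp only [neg_apply, Left.sign_neg] at hz
    rw [← neg_inj, hz]; simp
  obtain ⟨R', hR, hR'⟩ := S.exists_hasStrictFDerivAt_retract (D.curve_mem p)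
  have h1 : HasStrictFDerivAt (fun y => l (ζ (S.retract y))) (l.comp (P.comp R')) (D.curve p) := by
    refine HasStrictFDerivAt.comp (g := l) (D.curve p) l.hasStrictFDerivAt ?_
    refine HasStrictFDerivAt.comp (g := ζ) (D.curve p) ?_ hR
    rwa [Surface.retract_of_mem (D.curve_mem p)]
  have hwn : R' w = w := by rw [hR', hw, dot3_cross3_left, zero_smul, sub_zero]
  have h2 := eventually_sign_of_hasStrictFDerivAt (γ := fun s => D.curve (adv p s))
    (w := fun s => cross3 (S.normal (D.curve (adv p s))) (velocity D.curve (adv p s))) h1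
    (D.contDiff_curve_adv p).continuous.continuousAt (D.continuous_cross3_curve p).continuousAt
    (by simp) (by
      filter_upwards [h0] with s hs
      rwa [Surface.retract_of_mem (D.curve_mem _)]) (by simpa [← hw, hwn] using hpos)
  have h3 : ∀ᶠ z : ℝ × ℝ in 𝓝 0, l (ζ (D.curve (adv p z.1))) = 0 :=
    (continuous_fst.tendsto' (0 : ℝ × ℝ) 0 rfl).eventually h0
  filter_upwards [h2, h3] with z hz hz3
  rw [sign_pos hpos, mul_one]
  rcases lt_trichotomy z.2 0 with h | h | h
  · rw [sign_neg h]; exact sign_neg (hz.2 h)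
  · rw [h, collar_zero, hz3]
  · rw [sign_pos h]; exact sign_pos (hz.1 h)

end OrientedLinkDiagram

/-! ### The diagram in local charts, and functions locally constant off it -/

namespace LinkDiag

theorem det3_cross3_right (n a b : E3) :
    det3 n b (cross3 n a) = dot3 n n * dot3 a b - dot3 n a * dot3 n b := by
  simp [dot3, cross3, det3]; ring

theorem det3_cross3_right' (n a b : E3) :
    det3 b a (cross3 n a) = dot3 n b * dot3 a a - dot3 a b * dot3 n a := by
  simp [dot3, cross3, det3]; ring

/-- Expand `b` in the orthogonal vectors `n`, `a`, `n × a`. Tangency removes the first component and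
a vanishing determinant the last, leaving `(a · a) b = (a · b) a`. -/
theorem det3_ne_zero_of_linearIndependent {S : Surface} {x a b : E3} (hx : x ∈ S.carrier)
    (ha : dot3 (S.normal x) a = 0) (hb : dot3 (S.normal x) b = 0)
    (h : LinearIndependent ℝ ![a, b]) : det3 (S.normal x) a b ≠ 0 := by
  intro h0
  have h1 := det3_smul_eq (S.normal x) a (cross3 (S.normal x) a) b
  rw [det3_cross3_right (S.normal x) a b, det3_cross3, det3_cross3_right', h0, ha, hb,
    Surface.dot3_normal_self hx] at h1
  have h2 := LinearIndependent.pair_iff.1 h (-dot3 a b) (dot3 a a) (by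
    simp only [one_mul, zero_mul, mul_zero, sub_zero, zero_smul, zero_add, add_zero] at h1
    have h3 : dot3 a a • b = dot3 a b • a := by simpa using h1
    rw [h3, neg_smul, neg_add_cancel])
  have h3 : a = 0 := by simpa [dot3_self] using h2.2
  exact h.ne_zero 0 h3

namespace CrossChart

variable {S : Surface} {x a b : E3} {γ₁ γ₂ : ℝ → E3} (C : CrossChart S x a b γ₁ γ₂)
include C

theorem tendsto_ζ : Tendsto C.ζ (𝓝 x) (𝓝 0) := by
  have := C.hasStrictFDerivAt_ζ.continuousAt.tendsto
  rwa [C.ζ_self] at this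

theorem tendsto_H : Tendsto C.H (𝓝 0) (𝓝 x) := by
  have := C.hasStrictFDerivAt_H.continuousAt.tendsto
  rwa [C.H_zero] at this

theorem eventually_ζ {Q : ℝ × ℝ → Prop} (h : ∀ᶠ z in 𝓝 0, Q z) :
    ∀ᶠ y in 𝓝[S.carrier] x, Q (C.ζ y) :=
  nhdsWithin_le_nhds (C.tendsto_ζ.eventually h)

theorem eventually_H {Q : E3 → Prop} (h : ∀ᶠ y in 𝓝[S.carrier] x, Q y) :
    ∀ᶠ z in 𝓝 0, Q (C.H z) :=
  (tendsto_nhdsWithin_iff.2 ⟨C.tendsto_H, C.eventually_mem⟩).eventually h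

theorem eventually_ζ_fst (h : ∀ s, γ₁ s ∈ S.carrier) : ∀ᶠ s in 𝓝 0, C.ζ (γ₁ s) = (s, 0) := by
  have h1 : Tendsto (fun s : ℝ => (s, (0 : ℝ))) (𝓝 0) (𝓝 0) :=
    (continuous_id.prodMk continuous_const).tendsto' _ _ rfl
  filter_upwards [h1.eventually C.eventually_left] with s hs
  rwa [C.H_fst, Surface.retract_of_mem (h s)] at hs

theorem eventually_ζ_snd (h : ∀ s, γ₂ s ∈ S.carrier) : ∀ᶠ s in 𝓝 0, C.ζ (γ₂ s) = (0, s) := by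
  have h1 : Tendsto (fun s : ℝ => ((0 : ℝ), s)) (𝓝 0) (𝓝 0) :=
    (continuous_const.prodMk continuous_id).tendsto' _ _ rfl
  filter_upwards [h1.eventually C.eventually_left] with s hs
  rwa [C.H_snd, Surface.retract_of_mem (h s)] at hs

end CrossChart

end LinkDiag

namespace OrientedLinkDiagram

open LinkDiag

variable {S : LinkDiag.Surface} (D : OrientedLinkDiagram S)

theorem crossingDet_eq (p q : Circles D.n) : D.crossingDet p q =
    det3 (S.normal (D.curve p)) (velocity D.curve p) (velocity D.curve q) := by
  simp only [crossingDet, Matrix.det_fin_three, Matrix.of_apply, det3, Matrix.cons_val_zero,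
    Matrix.cons_val_one, Matrix.cons_val]
  ring

/-- Local coordinates at a crossing, with the strand of `p` and that of `q` as axes. -/
abbrev CrossingChart (p q : Circles D.n) : Type :=
  CrossChart S (D.curve p) (velocity D.curve p) (velocity D.curve q)
    (fun s => D.curve (adv p s)) (fun s => D.curve (adv q s))

/-- Local coordinates at a point of the link that is not a crossing, with the strand of `p`
as first axis. -/
abbrev StrandChart (p : Circles D.n) : Type :=
  CrossChart S (D.curve p) (velocity D.curve p)
    (cross3 (S.normal (D.curve p)) (velocity D.curve p)) (fun s => D.curve (adv p s))
    (fun t => D.curve p + t • cross3 (S.normal (D.curve p)) (velocity D.curve p))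

variable {D}

theorem crossingDet_ne_zero {p q : Circles D.n} (hpq : p ≠ q) (h : D.curve p = D.curve q) :
    D.crossingDet p q ≠ 0 := by
  rw [crossingDet_eq]
  exact det3_ne_zero_of_linearIndependent (D.curve_mem p) (D.dot3_normal_velocity p)
    (h ▸ D.dot3_normal_velocity q) (D.transverse p q hpq h)

theorem nonempty_crossingChart {p q : Circles D.n} (hpq : p ≠ q) (h : D.curve p = D.curve q) :
    Nonempty (D.CrossingChart p q) :=
  nonempty_crossChart (D.curve_mem p) (D.hasStrictDerivAt_curve p) (D.hasStrictDerivAt_curve q)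
    (by simp) (by simp [h]) (D.dot3_normal_velocity p) (h ▸ D.dot3_normal_velocity q)
    (by rw [← crossingDet_eq]; exact crossingDet_ne_zero hpq h)

variable (D) in
theorem det3_velocity_pos (p : Circles D.n) : 0 < det3 (S.normal (D.curve p))
    (velocity D.curve p) (cross3 (S.normal (D.curve p)) (velocity D.curve p)) :=
  Surface.det3_cross3_normal_pos (D.curve_mem p) (D.dot3_normal_velocity p) (D.immersed p)

variable (D) in
theorem nonempty_strandChart (p : Circles D.n) : Nonempty (D.StrandChart p) := by
  refine nonempty_crossChart (D.curve_mem p) (D.hasStrictDerivAt_curve p) ?_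
    (by simp) (by simp) (D.dot3_normal_velocity p) (dot3_cross3_left _ _)
    (D.det3_velocity_pos p).ne'
  have := ((hasStrictDerivAt_id (0 : ℝ)).smul_const
    (cross3 (S.normal (D.curve p)) (velocity D.curve p))).const_add (D.curve p)
  simpa using this

/-- As there are no triple points, only the strands of `p` and `q` come near, and the chart
straightens them to the axes; conversely, `H` carries points of the axes back to the curves. -/
theorem eventually_shadow_crossing {p q : Circles D.n} (hpq : p ≠ q) (h : D.curve p = D.curve q)
    (C : D.CrossingChart p q) : ∀ᶠ y in 𝓝[S.carrier] D.curve p,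
      (y ∈ D.shadow ↔ (C.ζ y).1 = 0 ∨ (C.ζ y).2 = 0) := by
  have h1 : ∀ᶠ y in 𝓝 (D.curve p), ∀ r, D.curve r = y →
      (C.ζ (D.curve r)).1 = 0 ∨ (C.ζ (D.curve r)).2 = 0 := by
    refine D.eventually_fiber fun r hr => ?_
    rcases D.no_triple p q r h (h.symm.trans hr.symm) with h' | rfl | rfl
    · exact absurd h' hpq
    · rw [← eventually_adv]
      filter_upwards [C.eventually_ζ_snd fun s => D.curve_mem _] with s hs
      simp [hs]
    · rw [← eventually_adv]
      filter_upwards [C.eventually_ζ_fst fun s => D.curve_mem _] with s hs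
      simp [hs]
  filter_upwards [C.eventually_right, nhdsWithin_le_nhds h1] with y hy1 hy2
  constructor
  · rintro ⟨r, rfl⟩
    exact hy2 r rfl
  · rintro (h0 | h0)
    · have h3 : C.ζ y = (0, (C.ζ y).2) := Prod.ext h0 rfl
      rw [h3, C.H_snd, Surface.retract_of_mem (D.curve_mem _)] at hy1
      exact ⟨_, hy1⟩
    · have h3 : C.ζ y = ((C.ζ y).1, 0) := Prod.ext rfl h0
      rw [h3, C.H_fst, Surface.retract_of_mem (D.curve_mem _)] at hy1
      exact ⟨_, hy1⟩

theorem eventually_shadow_strand {p : Circles D.n} (hp : D.Regular p) (C : D.StrandChart p) :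
    ∀ᶠ y in 𝓝[S.carrier] D.curve p, (y ∈ D.shadow ↔ (C.ζ y).2 = 0) := by
  have h1 : ∀ᶠ y in 𝓝 (D.curve p), ∀ r, D.curve r = y → (C.ζ (D.curve r)).2 = 0 := by
    refine D.eventually_fiber fun r hr => ?_
    rw [hp r hr, ← eventually_adv]
    filter_upwards [C.eventually_ζ_fst fun s => D.curve_mem _] with s hs
    simp [hs]
  filter_upwards [C.eventually_right, nhdsWithin_le_nhds h1] with y hy1 hy2
  constructor
  · rintro ⟨r, rfl⟩
    exact hy2 r rfl
  · intro h0
    have h3 : C.ζ y = ((C.ζ y).1, 0) := Prod.ext rfl h0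
    rw [h3, C.H_fst, Surface.retract_of_mem (D.curve_mem _)] at hy1
    exact ⟨_, hy1⟩

variable (D) in
/-- The function `f` is locally constant off the diagram near `x`. -/
def LocConst {T : Type*} (f : E3 → T) (x : E3) : Prop :=
  ∀ᶠ y in 𝓝[S.carrier] x, y ∉ D.shadow → ∀ᶠ z in 𝓝[S.carrier] y, f z = f y

/-- A small ball meets the convex set `A` in a connected set, and its image under `H` avoids the
diagram. -/
theorem LocConst.exists_const {T : Type*} {f : E3 → T} {x a b : E3} {γ₁ γ₂ : ℝ → E3}
    (hf : D.LocConst f x) (C : CrossChart S x a b γ₁ γ₂) {A : Set (ℝ × ℝ)} (hA : Convex ℝ A)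
    (hA' : ∀ᶠ z in 𝓝 0, z ∈ A → C.H z ∉ D.shadow) :
    ∃ g, ∀ᶠ y in 𝓝[S.carrier] x, C.ζ y ∈ A → f y = g := by
  let _ : TopologicalSpace T := ⊥
  have : DiscreteTopology T := ⟨rfl⟩
  obtain ⟨δ, hδ, hball⟩ := Metric.eventually_nhds_iff_ball.1 (hA'.and ((C.eventually_H hf).and
    (C.eventually_mem.and (eventually_continuousAt_of_hasStrictFDerivAt C.hasStrictFDerivAt_H))))
  have hconv : IsPreconnected (Metric.ball (0 : ℝ × ℝ) δ ∩ A) :=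
    ((convex_ball _ _).inter hA).isPreconnected
  have hcont : ContinuousOn (fun z => f (C.H z)) (Metric.ball 0 δ ∩ A) := by
    rintro z ⟨hz, hzA⟩
    obtain ⟨h1, h2, h3, h4⟩ := hball z hz
    have h5 : Tendsto C.H (𝓝[Metric.ball 0 δ ∩ A] z) (𝓝[S.carrier] C.H z) := by
      refine tendsto_nhdsWithin_iff.2 ⟨h4.tendsto.mono_left nhdsWithin_le_nhds, ?_⟩
      filter_upwards [self_mem_nhdsWithin] with w hw
      exact (hball w hw.1).2.2.1
    have h6 := h5.eventually (h2 (h1 hzA))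
    exact (tendsto_const_nhds.congr' (h6.mono fun y hy => hy.symm) :)
  rcases (Metric.ball (0 : ℝ × ℝ) δ ∩ A).eq_empty_or_nonempty with h | ⟨z₀, hz₀⟩
  · refine ⟨f x, ?_⟩
    filter_upwards [C.eventually_ζ (Metric.ball_mem_nhds 0 hδ)] with y hy hyA
    exact absurd (show C.ζ y ∈ Metric.ball (0 : ℝ × ℝ) δ ∩ A from ⟨hy, hyA⟩) (by simp [h])
  · refine ⟨f (C.H z₀), ?_⟩
    filter_upwards [C.eventually_ζ (Metric.ball_mem_nhds 0 hδ), C.eventually_right] with y hy hyr hyA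
    rw [← hyr]
    exact hconv.constant hcont ⟨hy, hyA⟩ hz₀

theorem convex_sign_eq (i : SignType) : Convex ℝ {x : ℝ | SignType.sign x = i} := by
  cases i
  · simp [sign_eq_zero_iff]
  · have : {x : ℝ | SignType.sign x = SignType.neg} = Iio 0 := by
      ext x; exact sign_eq_neg_one_iff
    rw [this]; exact convex_Iio 0
  · have : {x : ℝ | SignType.sign x = SignType.pos} = Ioi 0 := by
      ext x; exact sign_eq_one_iff
    rw [this]; exact convex_Ioi 0

theorem LocConst.exists_quadrants {T : Type*} {f : E3 → T} {p q : Circles D.n}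
    (hf : D.LocConst f (D.curve p)) (hpq : p ≠ q) (h : D.curve p = D.curve q)
    (C : D.CrossingChart p q) : ∃ F : SignType → SignType → T,
      ∀ᶠ y in 𝓝[S.carrier] D.curve p, (C.ζ y).1 ≠ 0 → (C.ζ y).2 ≠ 0 →
        f y = F (SignType.sign (C.ζ y).1) (SignType.sign (C.ζ y).2) := by
  have key : ∀ i j : SignType, ∃ g, ∀ᶠ y in 𝓝[S.carrier] D.curve p, (C.ζ y).1 ≠ 0 →
      (C.ζ y).2 ≠ 0 → SignType.sign (C.ζ y).1 = i → SignType.sign (C.ζ y).2 = j → f y = g := by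
    intro i j
    by_cases hij : i = 0 ∨ j = 0
    · refine ⟨f 0, Eventually.of_forall fun y h1 h2 h3 h4 => ?_⟩
      rcases hij with rfl | rfl
      · exact absurd (sign_eq_zero_iff.1 h3) h1
      · exact absurd (sign_eq_zero_iff.1 h4) h2
    · push Not at hij
      obtain ⟨g, hg⟩ := hf.exists_const C
        (A := {x : ℝ | SignType.sign x = i} ×ˢ {x : ℝ | SignType.sign x = j})
        ((convex_sign_eq i).prod (convex_sign_eq j)) (by
          filter_upwards [C.eventually_H (eventually_shadow_crossing hpq h C), C.eventually_left]
            with z hz hz2 hzA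
          rw [hz, hz2]
          rintro (h0 | h0)
          · exact hij.1 (hzA.1.symm.trans (sign_eq_zero_iff.2 h0))
          · exact hij.2 (hzA.2.symm.trans (sign_eq_zero_iff.2 h0)))
      exact ⟨g, hg.mono fun y hy _ _ h3 h4 => hy ⟨h3, h4⟩⟩
  choose F hF using key
  refine ⟨F, ?_⟩
  have := eventually_all.2 fun i => eventually_all.2 fun j => hF i j
  filter_upwards [this] with y hy h1 h2
  exact hy _ _ h1 h2 rfl rfl

theorem LocConst.exists_sides {T : Type*} {f : E3 → T} {p : Circles D.n}
    (hf : D.LocConst f (D.curve p)) (hp : D.Regular p) (C : D.StrandChart p) :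
    ∃ F : SignType → T, ∀ᶠ y in 𝓝[S.carrier] D.curve p, (C.ζ y).2 ≠ 0 →
        f y = F (SignType.sign (C.ζ y).2) := by
  have key : ∀ j : SignType, ∃ g, ∀ᶠ y in 𝓝[S.carrier] D.curve p,
      (C.ζ y).2 ≠ 0 → SignType.sign (C.ζ y).2 = j → f y = g := by
    intro j
    by_cases hj : j = 0
    · refine ⟨f 0, Eventually.of_forall fun y h2 h4 => ?_⟩
      exact absurd (sign_eq_zero_iff.1 (h4.trans hj)) h2
    · obtain ⟨g, hg⟩ := hf.exists_const C
        (A := univ ×ˢ {x : ℝ | SignType.sign x = j}) (convex_univ.prod (convex_sign_eq j)) (by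
          filter_upwards [C.eventually_H (eventually_shadow_strand hp C), C.eventually_left]
            with z hz hz2 hzA
          rw [hz, hz2]
          intro h0
          exact hj (hzA.2.symm.trans (sign_eq_zero_iff.2 h0)))
      exact ⟨g, hg.mono fun y hy _ h4 => hy ⟨mem_univ _, h4⟩⟩
  choose F hF using key
  refine ⟨F, ?_⟩
  filter_upwards [eventually_all.2 hF] with y hy h2
  exact hy _ h2 rfl

theorem eventually_collar {p : Circles D.n} {Q : E3 → Prop}
    (h : ∀ᶠ y in 𝓝[S.carrier] D.curve p, Q y) :
    ∀ᶠ s in 𝓝 (0 : ℝ), ∀ᶠ t in 𝓝 (0 : ℝ), Q (D.collar (adv p s) t) :=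
  ((D.tendsto_collar p).eventually h).curry_nhds

theorem eventually_sign_eq {α : Type*} {l : Filter α} {u : α → ℝ} {c : ℝ} (hc : c ≠ 0)
    (hu : Tendsto u l (𝓝 c)) : ∀ᶠ t in l, SignType.sign (u t) = SignType.sign c := by
  have := (continuousAt_sign_of_ne_zero hc).tendsto.comp hu
  rw [nhds_discrete, tendsto_pure] at this
  exact this

theorem sign_div_of_pos {a : ℝ} (ha : 0 < a) (b : ℝ) :
    SignType.sign (a / b) = SignType.sign b := by
  rcases lt_trichotomy b 0 with h | rfl | h
  · rw [sign_neg h, sign_neg (div_neg_of_pos_of_neg ha h)]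
  · simp
  · rw [sign_pos h, sign_pos (div_pos ha h)]

theorem eventually_ζ_collar {p : Circles D.n} {a b : E3} {ζ : E3 → ℝ × ℝ}
    (hζ : HasStrictFDerivAt ζ (planeCoord (S.normal (D.curve p)) a b) (D.curve p)) :
    ∀ᶠ s in 𝓝 (0 : ℝ), Tendsto (fun t => ζ (D.collar (adv p s) t)) (𝓝 0)
      (𝓝 (ζ (D.curve (adv p s)))) := by
  have := (D.contDiff_curve_adv p).continuous.tendsto 0
  rw [adv_zero] at this
  filter_upwards [this.eventually (eventually_continuousAt_of_hasStrictFDerivAt hζ)] with s hs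
  exact hs.tendsto.comp ((D.tendsto_collar_zero _).mono_right nhdsWithin_le_nhds)

theorem eventually_collar_strand {T : Type*} {f : E3 → T} {p : Circles D.n}
    (C : D.StrandChart p) {F : SignType → T}
    (hF : ∀ᶠ y in 𝓝[S.carrier] D.curve p, (C.ζ y).2 ≠ 0 → f y = F (SignType.sign (C.ζ y).2)) :
    ∀ᶠ s in 𝓝 (0 : ℝ), ∀ᶠ t in 𝓝[≠] (0 : ℝ),
      f (D.collar (adv p s) t) = F (SignType.sign t) := by
  have h1 := D.eventually_sign_collar C.hasStrictFDerivAt_ζ (ContinuousLinearMap.snd ℝ ℝ ℝ) (by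
    filter_upwards [C.eventually_ζ_fst fun s => D.curve_mem _] with s hs
    simp [hs]) (by simp [planeCoord_apply, (D.det3_velocity_pos p).ne'])
  simp only [planeCoord_apply, ContinuousLinearMap.coe_snd', div_self (D.det3_velocity_pos p).ne',
    sign_one, mul_one] at h1
  filter_upwards [eventually_collar hF, h1.curry_nhds] with s h2 h3
  filter_upwards [nhdsWithin_le_nhds h2, nhdsWithin_le_nhds h3, self_mem_nhdsWithin] with t h2 h3 h4
  rw [h2 (by rw [← sign_ne_zero, h3, sign_ne_zero]; exact h4), h3]

/-- As `t → 0` the first coordinate tends to `s`, so it has the sign of `s`. The second has the sign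
of `t` times that of the component of `n × a` along `b`, which is a positive number divided by
`crossingDet`. -/
theorem eventually_collar_crossing_fst {T : Type*} {f : E3 → T} {p q : Circles D.n}
    (hpq : p ≠ q) (h : D.curve p = D.curve q) (C : D.CrossingChart p q)
    {F : SignType → SignType → T}
    (hF : ∀ᶠ y in 𝓝[S.carrier] D.curve p, (C.ζ y).1 ≠ 0 → (C.ζ y).2 ≠ 0 →
        f y = F (SignType.sign (C.ζ y).1) (SignType.sign (C.ζ y).2)) :
    ∀ᶠ s in 𝓝[≠] (0 : ℝ), ∀ᶠ t in 𝓝[≠] (0 : ℝ),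
      f (D.collar (adv p s) t) =
        F (SignType.sign s) (SignType.sign t * SignType.sign (D.crossingDet p q)) := by
  have hdet := crossingDet_ne_zero hpq h
  have e : SignType.sign ((ContinuousLinearMap.snd ℝ ℝ ℝ) (planeCoord (S.normal (D.curve p))
      (velocity D.curve p) (velocity D.curve q)
      (cross3 (S.normal (D.curve p)) (velocity D.curve p)))) =
      SignType.sign (D.crossingDet p q) := by
    rw [planeCoord_apply, ← crossingDet_eq, ContinuousLinearMap.coe_snd']
    exact sign_div_of_pos (D.det3_velocity_pos p) _
  have h1 := D.eventually_sign_collar C.hasStrictFDerivAt_ζ (ContinuousLinearMap.snd ℝ ℝ ℝ) (by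
    filter_upwards [C.eventually_ζ_fst fun s => D.curve_mem _] with s hs
    simp [hs]) (by rw [← sign_ne_zero, e, sign_ne_zero]; exact hdet)
  rw [e] at h1
  rw [eventually_nhdsWithin_iff]
  filter_upwards [eventually_collar hF, h1.curry_nhds, eventually_ζ_collar C.hasStrictFDerivAt_ζ,
    C.eventually_ζ_fst fun s => D.curve_mem _] with s h2 h3 h4 h5 hs
  rw [h5] at h4
  have h6 := eventually_sign_eq hs ((continuous_fst.tendsto _).comp h4)
  filter_upwards [nhdsWithin_le_nhds h2, nhdsWithin_le_nhds h3, nhdsWithin_le_nhds h6,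
    self_mem_nhdsWithin] with t h2 h3 h6 h7
  simp only [Function.comp_apply] at h6
  simp only [ContinuousLinearMap.coe_snd'] at h3
  rw [h2 (by rw [← sign_ne_zero, h6, sign_ne_zero]; exact hs) (by
    rw [← sign_ne_zero, h3]
    exact mul_ne_zero (sign_ne_zero.2 h7) (sign_ne_zero.2 hdet)), h3, h6]

/-- Here the component of `n × b` along `a` is a negative number divided by `crossingDet`, whence
the sign: the left of the understrand is the negative side of the first coordinate when the
determinant is positive. -/
theorem eventually_collar_crossing_snd {T : Type*} {f : E3 → T} {p q : Circles D.n}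
    (hpq : p ≠ q) (h : D.curve p = D.curve q) (C : D.CrossingChart p q)
    {F : SignType → SignType → T}
    (hF : ∀ᶠ y in 𝓝[S.carrier] D.curve p, (C.ζ y).1 ≠ 0 → (C.ζ y).2 ≠ 0 →
        f y = F (SignType.sign (C.ζ y).1) (SignType.sign (C.ζ y).2)) :
    ∀ᶠ s in 𝓝[≠] (0 : ℝ), ∀ᶠ t in 𝓝[≠] (0 : ℝ),
      f (D.collar (adv q s) t) =
        F (-(SignType.sign t * SignType.sign (D.crossingDet p q))) (SignType.sign s) := by
  have hdet := crossingDet_ne_zero hpq h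
  have hq : ∀ u, det3 (S.normal (D.curve q)) u (velocity D.curve q) =
      det3 (S.normal (D.curve p)) u (velocity D.curve q) := by simp [h]
  have hζ : HasStrictFDerivAt C.ζ (planeCoord (S.normal (D.curve q)) (velocity D.curve p)
      (velocity D.curve q)) (D.curve q) := h ▸ C.hasStrictFDerivAt_ζ
  have e : SignType.sign ((ContinuousLinearMap.fst ℝ ℝ ℝ) (planeCoord (S.normal (D.curve q))
      (velocity D.curve p) (velocity D.curve q)
      (cross3 (S.normal (D.curve q)) (velocity D.curve q)))) =
      -SignType.sign (D.crossingDet p q) := by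
    have e1 := D.det3_velocity_pos q
    rw [det3_cross3] at e1
    rw [planeCoord_apply, hq (velocity D.curve p), ← crossingDet_eq, ContinuousLinearMap.coe_fst',
      det3_cross3_swap, neg_div, Left.sign_neg, sign_div_of_pos e1]
  have h1 := D.eventually_sign_collar hζ (ContinuousLinearMap.fst ℝ ℝ ℝ) (by
    filter_upwards [C.eventually_ζ_snd fun s => D.curve_mem _] with s hs
    simp [hs]) (by
      rw [← sign_ne_zero, e]
      simpa using hdet)
  rw [e] at h1
  rw [eventually_nhdsWithin_iff]
  have hN : 𝓝[S.carrier] D.curve p = 𝓝[S.carrier] D.curve q := by rw [h]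
  rw [hN] at hF
  filter_upwards [eventually_collar hF, h1.curry_nhds, eventually_ζ_collar hζ,
    C.eventually_ζ_snd fun s => D.curve_mem _] with s h2 h3 h4 h5 hs
  rw [h5] at h4
  have h6 := eventually_sign_eq hs ((continuous_snd.tendsto _).comp h4)
  filter_upwards [nhdsWithin_le_nhds h2, nhdsWithin_le_nhds h3, nhdsWithin_le_nhds h6,
    self_mem_nhdsWithin] with t h2 h3 h6 h7
  simp only [Function.comp_apply] at h6
  simp only [ContinuousLinearMap.coe_fst', mul_neg] at h3
  rw [h2 (by
    rw [← sign_ne_zero, h3, ← neg_mul]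
    exact mul_ne_zero (by simpa using h7) (sign_ne_zero.2 hdet))
    (by rw [← sign_ne_zero, h6, sign_ne_zero]; exact hs), h3, h6]

end OrientedLinkDiagram

/-! ### Potentials near a point: existence and uniqueness up to a left factor -/

namespace OrientedLinkDiagram

open LinkDiag

variable {S : LinkDiag.Surface} {D : OrientedLinkDiagram S} {G : Type*} [Group G]

variable (D) in
/-- On the two sides of the link at `r`, the values of `f` differ by the factor `g`. -/
def Jump (f : E3 → G) (r : Circles D.n) (g : G) : Prop :=
  ∀ᶠ t in 𝓝[>] (0 : ℝ), f (D.collar r t) = f (D.collar r (-t)) * g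

variable (D) in
/-- Near `x`, the function `f` is a potential for `m`: it is locally constant off the diagram, and
jumps by the factor `m r` from the right to the left of the link at `r`. -/
def IsPotentialAt (m : Circles D.n → G) (f : E3 → G) (x : E3) : Prop :=
  D.LocConst f x ∧ ∀ p, D.curve p = x → ∀ᶠ r in 𝓝 p, D.Regular r → D.Jump f r (m r)

variable (D) in
/-- A function on the circles that is constant on the arcs and satisfies the Wirtinger relations. -/
structure IsColoring (m : Circles D.n → G) : Prop where
  eventually_eq : ∀ p ∉ D.under, ∀ᶠ r in 𝓝 p, m r = m p
  crossing : ∀ p q, D.IsCrossing p q → ∃ l r : G,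
    (∀ᶠ s in 𝓝[<] (0 : ℝ), m (adv q s) = l) ∧ (∀ᶠ s in 𝓝[>] (0 : ℝ), m (adv q s) = r) ∧
    (0 < D.crossingDet p q → m p * r = l * m p) ∧ (D.crossingDet p q < 0 → m p * l = r * m p)

theorem jump_iff {f : E3 → G} {r : Circles D.n} {F : SignType → G}
    (h : ∀ᶠ t in 𝓝[≠] (0 : ℝ), f (D.collar r t) = F (SignType.sign t)) (g : G) :
    D.Jump f r g ↔ F 1 = F (-1) * g := by
  have h1 : ∀ᶠ t in 𝓝[>] (0 : ℝ), f (D.collar r t) = F 1 := by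
    filter_upwards [nhdsWithin_mono _ (fun t (ht : 0 < t) => ht.ne') h, self_mem_nhdsWithin]
      with t ht ht0
    rw [ht, sign_pos ht0]
  have h2 : ∀ᶠ t in 𝓝[>] (0 : ℝ), f (D.collar r (-t)) = F (-1) := by
    have h3 : Tendsto (fun t : ℝ => -t) (𝓝[>] 0) (𝓝[≠] 0) := by
      refine tendsto_nhdsWithin_iff.2 ⟨(continuous_neg.tendsto' 0 0 neg_zero).mono_left
        nhdsWithin_le_nhds, ?_⟩
      filter_upwards [self_mem_nhdsWithin] with t ht
      exact neg_ne_zero.2 (ne_of_gt ht)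
    filter_upwards [h3.eventually h, self_mem_nhdsWithin] with t ht ht0
    rw [ht, Left.sign_neg, sign_pos ht0]
  constructor
  · intro hJ
    obtain ⟨t, h1, h2, h3⟩ := (h1.and (h2.and hJ)).exists
    rwa [h1, h2] at h3
  · intro hF
    filter_upwards [h1, h2] with t h1 h2
    rw [h1, h2, hF]

theorem mem_nhdsWithin_compl_shadow {x : E3} (hx : x ∈ S.carrier \ D.shadow) :
    S.carrier \ D.shadow ∈ 𝓝[S.carrier] x := by
  filter_upwards [self_mem_nhdsWithin,
    nhdsWithin_le_nhds (D.isClosed_shadow.isOpen_compl.mem_nhds hx.2)] with y h1 h2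
  exact ⟨h1, h2⟩

theorem Regular.tendsto_collar {p : Circles D.n} (hp : D.Regular p) :
    Tendsto (D.collar p) (𝓝[≠] 0) (𝓝[S.carrier \ D.shadow] D.curve p) := by
  have h1 := tendsto_nhdsWithin_iff.1 ((D.tendsto_collar_zero p).mono_left
    (nhdsWithin_le_nhds (s := {0}ᶜ)))
  refine tendsto_nhdsWithin_iff.2 ⟨h1.1, ?_⟩
  obtain ⟨C⟩ := D.nonempty_strandChart p
  -- The general statement on two-sided values is applied to the truth value of `y ∉ D.shadow`,
  -- which is `True` on both sides.
  have h2 := eventually_collar_strand (f := fun y => y ∉ D.shadow) (F := fun _ => True) C (by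
    filter_upwards [eventually_shadow_strand hp C] with y hy hy0
    simp [hy, hy0])
  have h3 := h2.self_of_nhds
  rw [adv_zero] at h3
  filter_upwards [h1.2, h3] with t h4 h5
  exact ⟨h4, of_eq_true h5⟩

theorem trichotomy (x : E3) : x ∉ D.shadow ∨ (∃ p, D.Regular p ∧ D.curve p = x) ∨
    ∃ p q, D.IsCrossing p q ∧ D.curve p = x := by
  by_cases hx : x ∈ D.shadow
  · right
    obtain ⟨p, rfl⟩ := hx
    by_cases hp : D.Regular p
    · exact Or.inl ⟨p, hp, rfl⟩
    · right
      simp only [Regular, not_forall] at hp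
      obtain ⟨q, hq, hqp⟩ := hp
      by_cases hu : p ∈ D.under
      · exact ⟨q, p, ⟨hqp, hq, (D.under_iff p q (Ne.symm hqp) hq.symm).1 hu, hu⟩, hq⟩
      · refine ⟨p, q, ⟨Ne.symm hqp, hq.symm, hu, ?_⟩, rfl⟩
        by_contra hq'
        exact hu ((D.under_iff p q (Ne.symm hqp) hq.symm).2 hq')
  · exact Or.inl hx

theorem IsCrossing.eq_or_eq {p q r : Circles D.n} (h : D.IsCrossing p q)
    (hr : D.curve r = D.curve p) : r = p ∨ r = q := by
  rcases D.no_triple p q r h.2.1 (h.2.1.symm.trans hr.symm) with h' | rfl | rfl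
  · exact absurd h' h.1
  · exact Or.inr rfl
  · exact Or.inl rfl

theorem IsCrossing.not_regular_left {p q : Circles D.n} (h : D.IsCrossing p q) :
    ¬ D.Regular p := fun hp => h.1 (hp q h.2.1.symm).symm

theorem IsCrossing.not_regular_right {p q : Circles D.n} (h : D.IsCrossing p q) :
    ¬ D.Regular q := fun hq => h.1 (hq p h.2.1)

theorem neBot_nhdsWithin {x : E3} (hx : x ∈ S.carrier) :
    (𝓝[S.carrier \ D.shadow] x).NeBot := by
  have key : ∀ {x a b γ₁ γ₂} (C : CrossChart S x a b γ₁ γ₂), (∀ᶠ y in 𝓝[S.carrier] x,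
      (C.ζ y).1 ≠ 0 → (C.ζ y).2 ≠ 0 → y ∉ D.shadow) → (𝓝[S.carrier \ D.shadow] x).NeBot := by
    intro x a b γ₁ γ₂ C h
    -- The diagonal of the chart approaches `x` without meeting the axes.
    have h1 : Tendsto (fun t : ℝ => (t, t)) (𝓝[>] 0) (𝓝 0) :=
      ((continuous_id.prodMk continuous_id).tendsto' _ _ rfl).mono_left nhdsWithin_le_nhds
    have h2 : Tendsto (fun t : ℝ => C.H (t, t)) (𝓝[>] 0) (𝓝[S.carrier \ D.shadow] x) := by
      refine tendsto_nhdsWithin_iff.2 ⟨C.tendsto_H.comp h1, ?_⟩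
      filter_upwards [h1.eventually (C.eventually_H h), h1.eventually C.eventually_mem,
        h1.eventually C.eventually_left, self_mem_nhdsWithin] with t h3 h4 h5 h6
      rw [h5] at h3
      exact ⟨h4, h3 (ne_of_gt h6) (ne_of_gt h6)⟩
    exact h2.neBot
  rcases D.trichotomy x with h | ⟨p, hp, rfl⟩ | ⟨p, q, hpq, rfl⟩
  · exact mem_closure_iff_nhdsWithin_neBot.1 (subset_closure ⟨hx, h⟩)
  · obtain ⟨C⟩ := D.nonempty_strandChart p
    refine key C ?_
    filter_upwards [eventually_shadow_strand hp C] with y hy _ h2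
    rwa [hy]
  · obtain ⟨C⟩ := nonempty_crossingChart hpq.1 hpq.2.1
    refine key C ?_
    filter_upwards [eventually_shadow_crossing hpq.1 hpq.2.1 C] with y hy h1 h2
    rw [hy]
    exact not_or.2 ⟨h1, h2⟩

theorem IsPotentialAt.eventually {m : Circles D.n → G} {f : E3 → G} {x : E3}
    (h : D.IsPotentialAt m f x) : ∀ᶠ y in 𝓝[S.carrier] x, D.IsPotentialAt m f y := by
  have h1 : ∀ᶠ y in 𝓝[S.carrier] x, D.LocConst f y := eventually_eventually_nhdsWithin.2 h.1
  have h2 : ∀ᶠ y in 𝓝 x, ∀ r, D.curve r = y → ∀ᶠ r' in 𝓝 r, D.Regular r' → D.Jump f r' (m r') :=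
    D.eventually_fiber fun p hp => eventually_eventually_nhds.2 (h.2 p hp)
  filter_upwards [h1, nhdsWithin_le_nhds h2] with y h3 h4
  exact ⟨h3, h4⟩

theorem LocConst.congr {T : Type*} {f g : E3 → T} {x : E3} (hg : D.LocConst g x)
    (h : ∀ᶠ y in 𝓝[S.carrier \ D.shadow] x, f y = g y) : D.LocConst f x := by
  filter_upwards [hg, nhdsWithin_le_nhds (eventually_nhds_nhdsWithin.2 h), self_mem_nhdsWithin]
    with y h1 h2 hyS hy
  filter_upwards [h1 hy, eventually_nhdsWithin_iff.1 h2 |> nhdsWithin_le_nhds,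
    mem_nhdsWithin_compl_shadow ⟨hyS, hy⟩] with z h3 h4 h5
  rw [h4 h5, h2.self_of_nhdsWithin ⟨hyS, hy⟩, h3]

theorem LocConst.map {T T' : Type*} {f : E3 → T} {x : E3} (hf : D.LocConst f x) (u : T → T') :
    D.LocConst (fun y => u (f y)) x := by
  filter_upwards [hf] with y hy h
  filter_upwards [hy h] with z hz
  rw [hz]

theorem LocConst.mul {f g : E3 → G} {x : E3} (hf : D.LocConst f x)
    (hg : D.LocConst g x) : D.LocConst (fun y => f y * g y) x := by
  filter_upwards [hf, hg] with y hy hy' h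
  filter_upwards [hy h, hy' h] with z hz hz'
  rw [hz, hz']

theorem IsPotentialAt.congr {m : Circles D.n → G} {f g : E3 → G} {x : E3} (k : G)
    (hg : D.IsPotentialAt m g x) (h : ∀ᶠ y in 𝓝[S.carrier \ D.shadow] x, f y = k * g y) :
    D.IsPotentialAt m f x := by
  refine ⟨(hg.1.map (k * ·)).congr h, fun p hp => ?_⟩
  have h1 := D.continuous_curve.tendsto p |>.eventually (hp ▸ eventually_nhds_nhdsWithin.2 h)
  filter_upwards [h1, hg.2 p hp] with r h1 h2 hr
  have h3 := hr.tendsto_collar.eventually h1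
  have h4 : Tendsto (fun t : ℝ => -t) (𝓝[>] 0) (𝓝[≠] 0) := by
    refine tendsto_nhdsWithin_iff.2 ⟨(continuous_neg.tendsto' 0 0 neg_zero).mono_left
      nhdsWithin_le_nhds, ?_⟩
    filter_upwards [self_mem_nhdsWithin] with t ht
    exact neg_ne_zero.2 (ne_of_gt ht)
  filter_upwards [nhdsWithin_mono _ (fun t (ht : 0 < t) => ht.ne') h3, h4.eventually h3, h2 hr]
    with t h5 h6 h7
  rw [h5, h6, h7, mul_assoc]

theorem isPotentialAt_of_notMem {m : Circles D.n → G} {f : E3 → G} {x : E3} (hx : x ∉ D.shadow)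
    (hf : D.LocConst f x) : D.IsPotentialAt m f x :=
  ⟨hf, fun p hp => absurd ⟨p, hp⟩ hx⟩

theorem locConst_const {T : Type*} (c : T) (x : E3) : D.LocConst (fun _ => c) x :=
  Eventually.of_forall fun _ _ => Eventually.of_forall fun _ => rfl

/-- The jumps of a function at a crossing, in terms of its values in the four quadrants. -/
theorem IsCrossing.eventually_jump_fst_iff {p q : Circles D.n} (h : D.IsCrossing p q)
    (C : D.CrossingChart p q) {f : E3 → G} {F : SignType → SignType → G}
    (hF : ∀ᶠ y in 𝓝[S.carrier] D.curve p, (C.ζ y).1 ≠ 0 → (C.ζ y).2 ≠ 0 →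
        f y = F (SignType.sign (C.ζ y).1) (SignType.sign (C.ζ y).2)) :
    ∀ᶠ s in 𝓝[≠] (0 : ℝ), ∀ g, D.Jump f (adv p s) g ↔
      F (SignType.sign s) (SignType.sign (D.crossingDet p q)) =
        F (SignType.sign s) (-SignType.sign (D.crossingDet p q)) * g := by
  filter_upwards [eventually_collar_crossing_fst h.1 h.2.1 C hF] with s hs g
  rw [jump_iff (F := fun t => F (SignType.sign s) (t * SignType.sign (D.crossingDet p q))) hs]
  simp

theorem IsCrossing.eventually_jump_snd_iff {p q : Circles D.n} (h : D.IsCrossing p q)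
    (C : D.CrossingChart p q) {f : E3 → G} {F : SignType → SignType → G}
    (hF : ∀ᶠ y in 𝓝[S.carrier] D.curve p, (C.ζ y).1 ≠ 0 → (C.ζ y).2 ≠ 0 →
        f y = F (SignType.sign (C.ζ y).1) (SignType.sign (C.ζ y).2)) :
    ∀ᶠ s in 𝓝[≠] (0 : ℝ), ∀ g, D.Jump f (adv q s) g ↔
      F (-SignType.sign (D.crossingDet p q)) (SignType.sign s) =
        F (SignType.sign (D.crossingDet p q)) (SignType.sign s) * g := by
  filter_upwards [eventually_collar_crossing_snd h.1 h.2.1 C hF] with s hs g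
  rw [jump_iff (F := fun t => F (-(t * SignType.sign (D.crossingDet p q))) (SignType.sign s)) hs]
  simp

theorem Regular.eventually_jump_iff {p : Circles D.n}
    (C : D.StrandChart p) {f : E3 → G} {F : SignType → G}
    (hF : ∀ᶠ y in 𝓝[S.carrier] D.curve p, (C.ζ y).2 ≠ 0 → f y = F (SignType.sign (C.ζ y).2)) :
    ∀ᶠ r in 𝓝 p, ∀ g, D.Jump f r g ↔ F 1 = F (-1) * g := by
  rw [← eventually_adv]
  filter_upwards [eventually_collar_strand C hF] with s hs g
  rw [jump_iff hs]

theorem nhdsGT_le_nhdsNE : 𝓝[>] (0 : ℝ) ≤ 𝓝[≠] 0 := nhdsWithin_mono _ fun _ h => ne_of_gt h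

theorem nhdsLT_le_nhdsNE : 𝓝[<] (0 : ℝ) ≤ 𝓝[≠] 0 := nhdsWithin_mono _ fun _ h => ne_of_lt h

theorem eventually_adv_punctured {p : Circles D.n} (hp : ¬ D.Regular p) {Q : Circles D.n → Prop} :
    (∀ᶠ r in 𝓝 p, D.Regular r → Q r) ↔ ∀ᶠ s in 𝓝[≠] (0 : ℝ), Q (adv p s) := by
  rw [← eventually_adv]
  constructor
  · intro h
    filter_upwards [nhdsWithin_le_nhds h, D.eventually_adv_regular p] with s h1 h2
    exact h1 h2
  · intro h
    rw [eventually_nhdsWithin_iff] at h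
    filter_upwards [h] with s hs hr
    refine hs ?_
    rintro rfl
    exact hp (by simpa using hr)

/-- A function with trivial jumps takes the same value on both sides of a strand. At a crossing,
equality across three of the four half-axes already identifies all four quadrants. -/
theorem exists_const_of_jump_one {f : E3 → G} {x : E3} (hx : x ∈ S.carrier)
    (hf : D.IsPotentialAt (fun _ => 1) f x) :
    ∃ h : G, ∀ᶠ y in 𝓝[S.carrier \ D.shadow] x, f y = h := by
  have hle : 𝓝[S.carrier \ D.shadow] x ≤ 𝓝[S.carrier] x := nhdsWithin_mono _ sdiff_subset
  rcases D.trichotomy x with h | ⟨p, hp, rfl⟩ | ⟨p, q, hpq, rfl⟩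
  · exact ⟨f x, hle (hf.1.self_of_nhdsWithin hx h)⟩
  · obtain ⟨C⟩ := D.nonempty_strandChart p
    obtain ⟨F, hF⟩ := hf.1.exists_sides hp C
    have h1 := ((Regular.eventually_jump_iff C hF).self_of_nhds 1).1 ((hf.2 p rfl).self_of_nhds hp)
    refine ⟨F 1, ?_⟩
    filter_upwards [hle hF, hle (eventually_shadow_strand hp C), self_mem_nhdsWithin]
      with y h2 h3 h4
    have h5 : (C.ζ y).2 ≠ 0 := fun h0 => h4.2 (h3.2 h0)
    rw [h2 h5]
    rcases lt_or_gt_of_ne h5 with h6 | h6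
    · rw [sign_neg h6, h1, mul_one]
    · rw [sign_pos h6]
  · obtain ⟨C⟩ := nonempty_crossingChart hpq.1 hpq.2.1
    obtain ⟨F, hF⟩ := hf.1.exists_quadrants hpq.1 hpq.2.1 C
    have h1 := (eventually_adv_punctured hpq.not_regular_left).1 (hf.2 p rfl)
    have h2 := (eventually_adv_punctured hpq.not_regular_right).1 (hf.2 q hpq.2.1.symm)
    have h3 := hpq.eventually_jump_fst_iff C hF
    have h4 := hpq.eventually_jump_snd_iff C hF
    set σ := SignType.sign (D.crossingDet p q) with hσ
    obtain ⟨s, hs1, hs3, hs2, hs4, hs⟩ := ((h1.filter_mono nhdsGT_le_nhdsNE).and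
      ((h3.filter_mono nhdsGT_le_nhdsNE).and
      ((h2.filter_mono nhdsGT_le_nhdsNE).and ((h4.filter_mono nhdsGT_le_nhdsNE).and
      (self_mem_nhdsWithin : ∀ᶠ s in 𝓝[>] (0 : ℝ), s ∈ Ioi 0))))).exists
    obtain ⟨t, ht1, ht3, ht⟩ := ((h1.filter_mono nhdsLT_le_nhdsNE).and
      ((h3.filter_mono nhdsLT_le_nhdsNE).and
      (self_mem_nhdsWithin : ∀ᶠ s in 𝓝[<] (0 : ℝ), s ∈ Iio 0))).exists
    have e1 := (hs3 1).1 hs1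
    have e2 := (hs4 1).1 hs2
    have e3 := (ht3 1).1 ht1
    rw [sign_pos hs, mul_one] at e1 e2
    rw [sign_neg ht, mul_one] at e3
    have e4 : F 1 1 = F 1 (-1) ∧ F (-1) 1 = F 1 1 ∧ F (-1) 1 = F (-1) (-1) := by
      rcases lt_or_gt_of_ne (crossingDet_ne_zero hpq.1 hpq.2.1) with h | h
      · rw [hσ, sign_neg h] at e1 e2 e3
        simp only [neg_neg] at e1 e2 e3
        exact ⟨e1.symm, e2.symm, e3.symm⟩
      · rw [hσ, sign_pos h] at e1 e2 e3
        exact ⟨e1, e2, e3⟩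
    refine ⟨F 1 1, ?_⟩
    filter_upwards [hle hF, hle (eventually_shadow_crossing hpq.1 hpq.2.1 C), self_mem_nhdsWithin]
      with y h2 h3 h4
    have h5 := not_or.1 fun h0 => h4.2 (h3.2 h0)
    rw [h2 h5.1 h5.2]
    rcases lt_or_gt_of_ne h5.1 with h6 | h6 <;> rcases lt_or_gt_of_ne h5.2 with h7 | h7
    · rw [sign_neg h6, sign_neg h7, ← e4.2.1, e4.2.2]
    · rw [sign_neg h6, sign_pos h7, e4.2.1]
    · rw [sign_pos h6, sign_neg h7, e4.1]
    · rw [sign_pos h6, sign_pos h7]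

/-- The jumps act on the right and so cancel in `f * g⁻¹`, which leaves a left factor. -/
theorem IsPotentialAt.exists_const {m : Circles D.n → G} {f g : E3 → G} {x : E3}
    (hx : x ∈ S.carrier) (hf : D.IsPotentialAt m f x) (hg : D.IsPotentialAt m g x) :
    ∃ h : G, ∀ᶠ y in 𝓝[S.carrier \ D.shadow] x, f y = h * g y := by
  obtain ⟨h, hh⟩ := exists_const_of_jump_one (f := fun y => f y * (g y)⁻¹) hx
    ⟨hf.1.mul (hg.1.map (·⁻¹)), fun p hp => by
      filter_upwards [hf.2 p hp, hg.2 p hp] with r h1 h2 hr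
      filter_upwards [h1 hr, h2 hr] with t h3 h4
      rw [h3, h4]; group⟩
  refine ⟨h, ?_⟩
  filter_upwards [hh] with y hy
  rw [← hy, inv_mul_cancel_right]

theorem locConst_of_sign {T : Type*} {x a b : E3} {γ₁ γ₂ : ℝ → E3} (C : CrossChart S x a b γ₁ γ₂)
    (F : SignType → SignType → T) (h : ∀ᶠ y in 𝓝[S.carrier] x, y ∉ D.shadow →
      (C.ζ y).1 ≠ 0 ∧ (C.ζ y).2 ≠ 0) :
    D.LocConst (fun y => F (SignType.sign (C.ζ y).1) (SignType.sign (C.ζ y).2)) x := by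
  filter_upwards [h, nhdsWithin_le_nhds
    (eventually_continuousAt_of_hasStrictFDerivAt C.hasStrictFDerivAt_ζ)] with y h1 h2 hy
  have h3 := h2.tendsto.mono_left (nhdsWithin_le_nhds (s := S.carrier))
  filter_upwards [eventually_sign_eq (h1 hy).1 ((continuous_fst.tendsto _).comp h3),
    eventually_sign_eq (h1 hy).2 ((continuous_snd.tendsto _).comp h3)] with z h4 h5
  simp only [Function.comp_apply] at h4 h5
  rw [h4, h5]

theorem locConst_of_sign_snd {T : Type*} {x a b : E3} {γ₁ γ₂ : ℝ → E3}
    (C : CrossChart S x a b γ₁ γ₂) (F : SignType → T)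
    (h : ∀ᶠ y in 𝓝[S.carrier] x, y ∉ D.shadow → (C.ζ y).2 ≠ 0) :
    D.LocConst (fun y => F (SignType.sign (C.ζ y).2)) x := by
  filter_upwards [h, nhdsWithin_le_nhds
    (eventually_continuousAt_of_hasStrictFDerivAt C.hasStrictFDerivAt_ζ)] with y h1 h2 hy
  have h3 := h2.tendsto.mono_left (nhdsWithin_le_nhds (s := S.carrier))
  filter_upwards [eventually_sign_eq (h1 hy) ((continuous_snd.tendsto _).comp h3)] with z h5
  simp only [Function.comp_apply] at h5
  rw [h5]

/-- The Wirtinger relation closes the cycle around a crossing. Here `σ` is the sign of the crossing,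
`a` the colour of the overstrand, and `l`, `r` those of the arriving and departing halves of the
understrand. -/
theorem exists_quadrant_values {σ : SignType} (a l r : G) (hσ : σ ≠ 0)
    (h1 : σ = 1 → a * r = l * a) (h2 : σ = -1 → a * l = r * a) :
    ∃ F : SignType → SignType → G, F 1 σ = F 1 (-σ) * a ∧ F (-1) σ = F (-1) (-σ) * a ∧
      F (-σ) 1 = F σ 1 * r ∧ F (-σ) (-1) = F σ (-1) * l := by
  cases σ
  · exact absurd rfl hσ
  -- The quadrant `(σ, -σ)` gets the value `1`; the jumps force two of the other values, and the
  -- relation makes the two expressions for the last one agree. The case `σ = 1` is analogous.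
  · refine ⟨fun i j => if i = 1 then (if j = 1 then r else r * a) else if j = 1 then 1 else a, ?_⟩
    have := h2 rfl
    simp [SignType.neg_eq_neg_one, this]
  · refine ⟨fun i j => if i = 1 then (if j = 1 then a else 1) else if j = 1 then l * a else l, ?_⟩
    have := h1 rfl
    simp [SignType.pos_eq_one, this]

theorem IsColoring.exists_isPotentialAt {m : Circles D.n → G} (hm : D.IsColoring m) {x : E3} :
    ∃ f, D.IsPotentialAt m f x := by
  rcases D.trichotomy x with h | ⟨p, hp, rfl⟩ | ⟨p, q, hpq, rfl⟩
  · exact ⟨fun _ => 1, isPotentialAt_of_notMem h (locConst_const _ _)⟩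
  · obtain ⟨C⟩ := D.nonempty_strandChart p
    -- The value is `1` on the right of the strand and its colour on the left.
    let F : SignType → G := fun i => if i = 1 then m p else 1
    refine ⟨fun y => F (SignType.sign (C.ζ y).2), locConst_of_sign_snd C F ?_, fun r hr => ?_⟩
    · filter_upwards [eventually_shadow_strand hp C] with y hy h
      rwa [hy] at h
    · rw [hp r hr]
      filter_upwards [hm.eventually_eq p hp.notMem_under, Regular.eventually_jump_iff C
        (f := fun y => F (SignType.sign (C.ζ y).2)) (Eventually.of_forall fun y _ => rfl)]
        with r h1 h2 _
      rw [h2, h1]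
      simp [F]
  · obtain ⟨C⟩ := nonempty_crossingChart hpq.1 hpq.2.1
    have hdet := crossingDet_ne_zero hpq.1 hpq.2.1
    obtain ⟨l, r, hl, hr, h1, h2⟩ := hm.crossing p q hpq
    obtain ⟨F, hF1, hF2, hF3, hF4⟩ := exists_quadrant_values (m p) l r (sign_ne_zero.2 hdet)
      (fun h => h1 (sign_eq_one_iff.1 h)) (fun h => h2 (sign_eq_neg_one_iff.1 h))
    refine ⟨fun y => F (SignType.sign (C.ζ y).1) (SignType.sign (C.ζ y).2),
      locConst_of_sign C F ?_, fun r' hr' => ?_⟩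
    · filter_upwards [eventually_shadow_crossing hpq.1 hpq.2.1 C] with y hy h
      rw [hy] at h
      exact not_or.1 h
    · rcases hpq.eq_or_eq hr' with rfl | rfl
      · rw [eventually_adv_punctured hpq.not_regular_left]
        filter_upwards [hpq.eventually_jump_fst_iff C
          (f := fun y => F (SignType.sign (C.ζ y).1) (SignType.sign (C.ζ y).2))
          (Eventually.of_forall fun y _ _ => rfl),
          nhdsWithin_le_nhds (eventually_adv.2 (hm.eventually_eq _ hpq.2.2.1)),
          self_mem_nhdsWithin] with s h3 h4 h5
        rw [h3, h4]
        rcases lt_or_gt_of_ne h5 with h6 | h6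
        · rwa [sign_neg h6]
        · rwa [sign_pos h6]
      · rw [eventually_adv_punctured hpq.not_regular_right]
        rw [eventually_nhdsWithin_iff] at hl hr
        filter_upwards [hpq.eventually_jump_snd_iff C
          (f := fun y => F (SignType.sign (C.ζ y).1) (SignType.sign (C.ζ y).2))
          (Eventually.of_forall fun y _ _ => rfl),
          nhdsWithin_le_nhds hl, nhdsWithin_le_nhds hr,
          self_mem_nhdsWithin] with s h3 h4 h4' h5
        rw [h3]
        rcases lt_or_gt_of_ne h5 with h6 | h6
        · rwa [sign_neg h6, h4 h6]
        · rwa [sign_pos h6, h4' h6]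

theorem IsColoring.isTorsorSheaf {m : Circles D.n → G} (hm : D.IsColoring m) :
    IsTorsorSheaf S.carrier (S.carrier \ D.shadow) (D.IsPotentialAt m) where
  neBot _ hx := neBot_nhdsWithin hx
  eventually _ _ _ h := h.eventually
  exists_at _ _ := hm.exists_isPotentialAt
  unique _ _ _ hx hf hg := hf.exists_const hx hg
  congr _ _ k _ _ hg h := hg.congr k h

end OrientedLinkDiagram

/-! ### A planar chart containing the whole diagram -/

namespace LinkDiag

namespace Surface

/-- A compact proper subset of the surface lies in the domain of a global chart. -/
theorem exists_isEmbedding (S : Surface) {Γ : Set E3} (hΓ : Γ ⊆ S.carrier) {x₀ : E3}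
    (hx₀ : x₀ ∈ S.carrier \ Γ) : ∃ e : ℝ × ℝ → E3, IsEmbedding e ∧ (∀ z, e z ∈ S.carrier) ∧
      (∀ z, range e ∈ 𝓝[S.carrier] (e z)) ∧ Γ ⊆ range e := by
  cases S
  · let e : ℝ × ℝ → E3 := fun z => !₂[z.1, z.2, 0]
    have hrange : Surface.plane.carrier ⊆ range e := by
      intro y hy
      have : y 2 = 0 := hy
      exact ⟨(y 0, y 1), ext3 (by simp [e]) (by simp [e]) (by simp [e, this])⟩
    refine ⟨e, ?_, fun z => by simp [e, carrier],
      fun z => mem_of_superset self_mem_nhdsWithin hrange, hΓ.trans hrange⟩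
    refine Function.LeftInverse.isEmbedding (f := fun y : E3 => (y 0, y 1)) (g := e)
      (fun z => by simp [e]) (by fun_prop) ?_
    refine (PiLp.continuous_toLp 2 _).comp (continuous_pi fun i => ?_)
    fin_cases i <;> simp <;> fun_prop
  · have : Fact (Module.finrank ℝ E3 = 2 + 1) := ⟨by simp⟩
    -- Stereographic projection is centred at a point off the diagram.
    let v : Metric.sphere (0 : E3) 1 := ⟨x₀, hx₀.1⟩
    let ψ : (ℝ × ℝ) ≃L[ℝ] EuclideanSpace ℝ (Fin 2) :=
      ContinuousLinearEquiv.ofFinrankEq (by simp)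
    let st := (stereographic' 2 v).symm
    have hst : st.source = univ := stereographic'_target v
    have hrange : Surface.sphere.carrier ∩ {x₀}ᶜ ⊆ range fun z => (st (ψ z) : E3) := by
      rintro y ⟨hy, hyx⟩
      have h1 : (⟨y, hy⟩ : Metric.sphere (0 : E3) 1) ∈ (stereographic' 2 v).source := by
        rw [stereographic'_source]
        intro h
        exact hyx (congrArg Subtype.val h)
      refine ⟨ψ.symm (stereographic' 2 v ⟨y, hy⟩), ?_⟩
      simp only [ContinuousLinearEquiv.apply_symm_apply, st]
      rw [(stereographic' 2 v).left_inv h1]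
    refine ⟨fun z => (st (ψ z) : E3), ?_, fun z => (st (ψ z)).2, fun z => ?_, ?_⟩
    · exact IsEmbedding.subtypeVal.comp ((st.isOpenEmbedding hst).isEmbedding.comp
        ψ.toHomeomorph.isEmbedding)
    · have h1 : (st (ψ z) : E3) ≠ x₀ := by
        intro h
        have h2 : st (ψ z) ∈ (stereographic' 2 v).source :=
          (stereographic' 2 v).map_target (by rw [stereographic'_target]; trivial)
        rw [stereographic'_source] at h2
        exact h2 (Subtype.ext h)
      filter_upwards [self_mem_nhdsWithin, nhdsWithin_le_nhds (isOpen_ne.mem_nhds h1)] with y h2 h3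
      exact hrange ⟨h2, h3⟩
    · intro y hy
      exact hrange ⟨hΓ hy, fun h => hx₀.2 (h ▸ hy)⟩

theorem isPreconnected_carrier (S : Surface) : IsPreconnected S.carrier := by
  cases S
  · refine Convex.isPreconnected ?_
    intro x hx y hy s t _ _ _
    have h1 : x 2 = 0 := hx
    have h2 : y 2 = 0 := hy
    simp [carrier, h1, h2]
  · refine isPreconnected_sphere ?_ _ _
    rw [← Module.finrank_eq_rank]
    simp

theorem exists_tangent (S : Surface) (x : E3) :
    ∃ a : E3, a ≠ 0 ∧ dot3 (S.normal x) a = 0 := by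
  by_cases h : S.normal x 0 = 0 ∧ S.normal x 1 = 0
  · refine ⟨!₂[1, 0, 0], fun h0 => ?_, by simp [dot3, h.1]⟩
    have := congrArg (fun z : E3 => z 0) h0
    simp at this
  · refine ⟨!₂[-S.normal x 1, S.normal x 0, 0], fun h0 => h ?_, by simp [dot3]; ring⟩
    have h1 := congrArg (fun z : E3 => z 0) h0
    have h2 := congrArg (fun z : E3 => z 1) h0
    simp only [Matrix.cons_val_zero, Matrix.cons_val_one, PiLp.zero_apply,
      neg_eq_zero] at h1 h2
    exact ⟨h2, h1⟩

end Surface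

theorem sign_of_hasDerivWithinAt {u : ℝ → ℝ} {d : ℝ} (h0 : u 0 = 0)
    (h : HasDerivWithinAt u d (Ici 0) 0) (hd : d ≠ 0) :
    ∀ᶠ t in 𝓝[>] (0 : ℝ), SignType.sign (u t) = SignType.sign d := by
  have h1 := hasDerivWithinAt_iff_tendsto_slope.1 h
  have h2 : Ici (0 : ℝ) \ {0} = Ioi 0 := Ici_sdiff_left
  rw [h2] at h1
  filter_upwards [OrientedLinkDiagram.eventually_sign_eq hd h1, self_mem_nhdsWithin] with t ht ht0
  rw [← ht, slope_def_field, h0, sub_zero, sub_zero, div_eq_inv_mul, sign_mul,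
    sign_pos (inv_pos.2 ht0), one_mul]

end LinkDiag

/-! ### Global potentials and regions -/

namespace OrientedLinkDiagram

open LinkDiag

variable {S : LinkDiag.Surface} {D : OrientedLinkDiagram S} {G : Type*} [Group G]

variable (D) in
theorem shadow_subset : D.shadow ⊆ S.carrier := by
  rintro _ ⟨p, rfl⟩
  exact D.curve_mem p

theorem IsColoring.exists_global {m : Circles D.n → G} (hm : D.IsColoring m) (R₀ : D.Region) :
    ∃ f, ∀ x ∈ S.carrier, D.IsPotentialAt m f x := by
  -- The region serves only to provide a point off the diagram, which makes the diagram fit into a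
  -- planar chart.
  obtain ⟨⟨x₀, hx₀⟩, -⟩ := R₀.exists_rep
  obtain ⟨e, he, hS, hr, hΓ⟩ := S.exists_isEmbedding D.shadow_subset hx₀
  have hcomp : IsCompact (e ⁻¹' D.shadow) :=
    (he.isInducing.isCompact_preimage_iff hΓ).2 (isCompact_range D.continuous_curve)
  obtain ⟨r, hr0, hball⟩ := hcomp.isBounded.subset_ball_lt 0 0
  refine hm.isTorsorSheaf.exists_global sdiff_subset (e := e) (r := r) (fun z => ?_) hS
    he.injective hr0 fun x _ hxb => ?_
  · rw [he.map_nhds_eq]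
    refine le_antisymm (nhdsWithin_mono _ (range_subset_iff.2 hS)) ?_
    exact nhdsWithin_le_iff.2 (hr z)
  · refine isPotentialAt_of_notMem (fun hx => hxb ?_) (locConst_const (1 : G) x)
    obtain ⟨z, rfl⟩ := hΓ hx
    exact ⟨z, hball hx, rfl⟩

theorem regionAt_eq_of_isPreconnected {T : Set E3} (hT : IsPreconnected T)
    (hTS : T ⊆ S.carrier \ D.shadow) {x y : E3} (hx : x ∈ T) (hy : y ∈ T) :
    D.regionAt x (hTS hx) = D.regionAt y (hTS hy) := by
  have h1 : IsPreconnected ((↑) ⁻¹' T : Set {x : E3 // x ∈ S.carrier \ D.shadow}) := by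
    rw [← IsInducing.subtypeVal.isPreconnected_image, Subtype.image_preimage_coe,
      inter_eq_right.2 hTS]
    exact hT
  refine ConnectedComponents.coe_eq_coe'.2 ?_
  exact h1.subset_connectedComponent (x := ⟨y, hTS hy⟩) hy
    (show (⟨x, hTS hx⟩ : {x : E3 // x ∈ S.carrier \ D.shadow}) ∈ _ from hx)

/-- Regions are open because the surface is locally connected: the image under a chart of a small
ball is a connected neighbourhood off the diagram. -/
theorem eventually_regionAt {x : E3} (hx : x ∈ S.carrier \ D.shadow) :
    ∀ᶠ y in 𝓝[S.carrier] x, ∃ h, D.regionAt y h = D.regionAt x hx := by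
  obtain ⟨a, ha0, ha⟩ := S.exists_tangent x
  have hd : ∀ v : E3, HasStrictDerivAt (fun s : ℝ => x + s • v) v 0 := fun v => by
    simpa using ((hasStrictDerivAt_id (0 : ℝ)).smul_const v).const_add x
  obtain ⟨C⟩ := nonempty_crossChart hx.1 (hd a) (hd (cross3 (S.normal x) a)) (by simp) (by simp)
    ha (dot3_cross3_left _ _) (Surface.det3_cross3_normal_pos hx.1 ha ha0).ne'
  obtain ⟨δ, hδ, hball⟩ := Metric.eventually_nhds_iff_ball.1 ((C.eventually_H
    (mem_nhdsWithin_compl_shadow hx)).and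
    (eventually_continuousAt_of_hasStrictFDerivAt C.hasStrictFDerivAt_H))
  have hT : IsPreconnected (C.H '' Metric.ball 0 δ) :=
    (convex_ball _ _).isPreconnected.image _ fun z hz => (hball z hz).2.continuousWithinAt
  have hTS : C.H '' Metric.ball 0 δ ⊆ S.carrier \ D.shadow := by
    rintro _ ⟨z, hz, rfl⟩
    exact (hball z hz).1
  have hxT : x ∈ C.H '' Metric.ball 0 δ := ⟨0, Metric.mem_ball_self hδ, C.H_zero⟩
  filter_upwards [C.eventually_right, C.eventually_ζ (Metric.ball_mem_nhds 0 hδ)] with y h1 h2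
  have hy : y ∈ C.H '' Metric.ball 0 δ := ⟨_, h2, h1⟩
  exact ⟨hTS hy, regionAt_eq_of_isPreconnected hT hTS hy hxT⟩

open Classical in
variable (D) in
/-- A function on the regions as a function on the surface. -/
def onSurface {T : Type*} (c : T) (F : D.Region → T) (y : E3) : T :=
  if h : y ∈ S.carrier \ D.shadow then F (D.regionAt y h) else c

theorem onSurface_apply {T : Type*} (c : T) (F : D.Region → T) {y : E3}
    (h : y ∈ S.carrier \ D.shadow) : D.onSurface c F y = F (D.regionAt y h) := dif_pos h

theorem locConst_onSurface {T : Type*} (c : T) (F : D.Region → T) (x : E3) :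
    D.LocConst (D.onSurface c F) x := by
  filter_upwards [self_mem_nhdsWithin] with y hyS hy
  filter_upwards [eventually_regionAt ⟨hyS, hy⟩] with z ⟨hz, h⟩
  rw [onSurface_apply c F hz, onSurface_apply c F ⟨hyS, hy⟩, h]

variable (D) in
/-- The function `F` on the regions is a potential for `m`. -/
def IsPotential (m : Circles D.n → G) (F : D.Region → G) : Prop :=
  ∀ x ∈ S.carrier, D.IsPotentialAt m (D.onSurface 1 F) x

theorem IsColoring.exists_isPotential {m : Circles D.n → G} (hm : D.IsColoring m)
    (R₀ : D.Region) : ∃ F : D.Region → G, D.IsPotential m F ∧ F R₀ = 1 := by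
  obtain ⟨f, hf⟩ := hm.exists_global R₀
  let _ : TopologicalSpace G := ⊥
  have : DiscreteTopology G := ⟨rfl⟩
  have hcont : Continuous fun y : {x : E3 // x ∈ S.carrier \ D.shadow} => f y := by
    rw [continuous_iff_continuousAt]
    intro y
    have h1 := (hf y y.2.1).1.self_of_nhdsWithin y.2.1 y.2.2
    have h2 : Tendsto (fun z : {x : E3 // x ∈ S.carrier \ D.shadow} => (z : E3)) (𝓝 y)
        (𝓝[S.carrier] y) := tendsto_nhdsWithin_iff.2
      ⟨continuous_subtype_val.continuousAt, Eventually.of_forall fun z => z.2.1⟩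
    exact (tendsto_const_nhds.congr' ((h2.eventually h1).mono fun y hy => hy.symm) :)
  let F : D.Region → G := hcont.connectedComponentsLift
  have hF : ∀ y h, F (D.regionAt y h) = f y := fun y h => rfl
  -- Left multiplication by a constant preserves potentials and normalises the value at the base
  -- region.
  refine ⟨fun R => (F R₀)⁻¹ * F R, fun x hx => ?_, inv_mul_cancel _⟩
  refine (hf x hx).congr (F R₀)⁻¹ ?_
  filter_upwards [self_mem_nhdsWithin] with y hy
  rw [onSurface_apply _ _ hy, hF]

/-- On the connected surface the left factor relating two potentials is one constant for all
regions, and it is read off at `R₀`. -/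
theorem IsPotential.eq {m : Circles D.n → G} (hm : D.IsColoring m) {F F' : D.Region → G}
    (hF : D.IsPotential m F) (hF' : D.IsPotential m F') {R₀ : D.Region} (h : F R₀ = F' R₀) :
    F = F' := by
  obtain ⟨k, hk⟩ := hm.isTorsorSheaf.exists_const_of_isPreconnected subset_rfl
    S.isPreconnected_carrier hF hF'
  have key : ∀ R, F R = k * F' R := by
    intro R
    obtain ⟨⟨x, hx⟩, rfl⟩ := R.exists_rep
    have := (hk x hx.1).self_of_nhdsWithin hx
    rwa [onSurface_apply _ _ hx, onSurface_apply _ _ hx] at this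
  have hk1 : k = 1 := by
    have := key R₀
    rw [h] at this
    exact right_eq_mul.1 this
  funext R
  rw [key R, hk1, one_mul]

/-- A curve with initial velocity `i a + j b` has velocity `(i, j)` in the chart, so it enters the
quadrant with these signs, whatever the curve. Thus the directional description of regions in the
Dehn relations depends only on the quadrant. -/
theorem IsCrossing.exists_quadrant_regions {p q : Circles D.n} (h : D.IsCrossing p q)
    (R₀ : D.Region) (C : D.CrossingChart p q) : ∃ Q : SignType → SignType → D.Region,
      (∀ᶠ y in 𝓝[S.carrier] D.curve p, (C.ζ y).1 ≠ 0 → (C.ζ y).2 ≠ 0 →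
        ∃ h, D.regionAt y h = Q (SignType.sign (C.ζ y).1) (SignType.sign (C.ζ y).2)) ∧
      ∀ i j : ℝ, i ≠ 0 → j ≠ 0 → ∀ R, D.RegionInDirection R (D.curve p)
        (i • velocity D.curve p + j • velocity D.curve q) ↔
        R = Q (SignType.sign i) (SignType.sign j) := by
  -- The region containing a point is itself a locally constant function; `R₀` is its default value
  -- on the diagram.
  obtain ⟨Q, hQ⟩ := (locConst_onSurface R₀ id (D.curve p)).exists_quadrants h.1 h.2.1 C
  have hQ' : ∀ᶠ y in 𝓝[S.carrier] D.curve p, (C.ζ y).1 ≠ 0 → (C.ζ y).2 ≠ 0 →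
      ∃ h, D.regionAt y h = Q (SignType.sign (C.ζ y).1) (SignType.sign (C.ζ y).2) := by
    filter_upwards [hQ, eventually_shadow_crossing h.1 h.2.1 C, self_mem_nhdsWithin]
      with y h1 h2 hyS h3 h4
    have hy : y ∈ S.carrier \ D.shadow := ⟨hyS, fun h => (h2.1 h).elim h3 h4⟩
    have h5 := h1 h3 h4
    rw [onSurface_apply _ _ hy] at h5
    exact ⟨hy, h5⟩
  have hdet := crossingDet_ne_zero h.1 h.2.1
  rw [crossingDet_eq] at hdet
  refine ⟨Q, hQ', fun i j hi hj R => ⟨?_, ?_⟩⟩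
  · rintro ⟨c, hc0, hc, hcR⟩
    have h1 : HasDerivWithinAt (fun t => C.ζ (c t)) (i, j) (Ici 0) 0 := by
      have h0 := C.hasStrictFDerivAt_ζ.hasFDerivAt
      have h1 : HasFDerivAt C.ζ (planeCoord (S.normal (D.curve p)) (velocity D.curve p)
        (velocity D.curve q)) (c 0) := by rw [hc0]; exact h0
      have := h1.comp_hasDerivWithinAt (0 : ℝ) hc
      rwa [planeCoord_comb hdet] at this
    have h2 := sign_of_hasDerivWithinAt (by simp [hc0, C.ζ_self])
      ((ContinuousLinearMap.fst ℝ ℝ ℝ).hasFDerivAt.comp_hasDerivWithinAt 0 h1) hi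
    have h3 := sign_of_hasDerivWithinAt (by simp [hc0, C.ζ_self])
      ((ContinuousLinearMap.snd ℝ ℝ ℝ).hasFDerivAt.comp_hasDerivWithinAt 0 h1) hj
    have h4 : Tendsto c (𝓝[>] 0) (𝓝[S.carrier] D.curve p) := by
      refine tendsto_nhdsWithin_iff.2 ⟨?_, hcR.mono fun t ⟨ht, _⟩ => ht.1⟩
      have := hc.continuousWithinAt.tendsto.mono_left (nhdsWithin_mono _ Ioi_subset_Ici_self)
      rwa [hc0] at this
    obtain ⟨t, ht2, ht3, ht4, ⟨_, ht5⟩⟩ := (h2.and (h3.and ((h4.eventually hQ').and hcR))).exists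
    simp only [Function.comp_apply, ContinuousLinearMap.coe_fst',
      ContinuousLinearMap.coe_snd'] at ht2 ht3
    obtain ⟨_, ht6⟩ := ht4 (by rwa [← sign_ne_zero, ht2, sign_ne_zero])
      (by rwa [← sign_ne_zero, ht3, sign_ne_zero])
    rw [← ht5, ht6, ht2, ht3]
  · rintro rfl
    have h0 : HasDerivAt (fun t : ℝ => (t * i, t * j)) (i, j) 0 := by
      simpa using ((hasDerivAt_id (0 : ℝ)).mul_const i).prodMk
        ((hasDerivAt_id (0 : ℝ)).mul_const j)
    have h0' : Tendsto (fun t : ℝ => (t * i, t * j)) (𝓝[>] 0) (𝓝 0) :=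
      (Continuous.tendsto' (by fun_prop) _ _ (by simp)).mono_left nhdsWithin_le_nhds
    -- The witness is a straight ray in the chart.
    refine ⟨fun t => C.H (t * i, t * j), by
      simp only [zero_mul]
      exact C.H_zero, ?_, ?_⟩
    · have h1 : HasFDerivAt C.H ((ContinuousLinearMap.fst ℝ ℝ ℝ).smulRight
          (velocity D.curve p) + (ContinuousLinearMap.snd ℝ ℝ ℝ).smulRight (velocity D.curve q))
          ((0 : ℝ) * i, (0 : ℝ) * j) := by
        have := C.hasStrictFDerivAt_H.hasFDerivAt
        rw [zero_mul, zero_mul]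
        exact this
      have := HasFDerivAt.comp_hasDerivAt (0 : ℝ) (l := C.H) (f := fun t : ℝ => (t * i, t * j)) h1 h0
      have e : ((ContinuousLinearMap.fst ℝ ℝ ℝ).smulRight (velocity D.curve p) +
          (ContinuousLinearMap.snd ℝ ℝ ℝ).smulRight (velocity D.curve q)) (i, j) =
          i • velocity D.curve p + j • velocity D.curve q := by simp
      rw [e] at this
      exact this.hasDerivWithinAt
    · filter_upwards [h0'.eventually (C.eventually_H hQ'), h0'.eventually C.eventually_left,
        self_mem_nhdsWithin] with t h1 h2 ht
      have ht' : (0 : ℝ) < t := ht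
      rw [h2] at h1
      obtain ⟨hy, h3⟩ := h1 (mul_ne_zero ht'.ne' hi) (mul_ne_zero ht'.ne' hj)
      refine ⟨hy, ?_⟩
      rw [h3, sign_mul, sign_mul, sign_pos ht', one_mul, one_mul]

end OrientedLinkDiagram

/-! ### Group relations as conditions on colourings and potentials -/

namespace OrientedLinkDiagram

open LinkDiag

variable {S : LinkDiag.Surface} {D : OrientedLinkDiagram S} {G : Type*} [Group G]

theorem Jump.unique {f : E3 → G} {r : Circles D.n} {g g' : G} (h : D.Jump f r g)
    (h' : D.Jump f r g') : g = g' := by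
  obtain ⟨t, h1, h2⟩ := (h.and h').exists
  exact mul_left_cancel (h1.symm.trans h2)

theorem Jump.map {G' : Type*} [Group G'] {f : E3 → G} {r : Circles D.n} {g : G}
    (h : D.Jump f r g) (φ : G →* G') : D.Jump (fun y => φ (f y)) r (φ g) := by
  filter_upwards [h] with t ht
  rw [ht, map_mul]

theorem IsPotential.map {G' : Type*} [Group G'] {m : Circles D.n → G} {F : D.Region → G}
    (h : D.IsPotential m F) (φ : G →* G') :
    D.IsPotential (fun p => φ (m p)) (fun R => φ (F R)) := by
  intro x hx
  have h1 : D.onSurface 1 (fun R => φ (F R)) = fun y => φ (D.onSurface 1 F y) := by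
    funext y
    by_cases hy : y ∈ S.carrier \ D.shadow
    · rw [onSurface_apply _ _ hy, onSurface_apply _ _ hy]
    · simp [onSurface, hy]
  rw [h1]
  refine ⟨(h x hx).1.map φ, fun p hp => ?_⟩
  filter_upwards [(h x hx).2 p hp] with r hr hreg
  exact (hr hreg).map φ

theorem IsPotential.jump {m : Circles D.n → G} {F : D.Region → G} (h : D.IsPotential m F)
    {p : Circles D.n} (hp : D.Regular p) : D.Jump (D.onSurface 1 F) p (m p) :=
  ((h _ (D.curve_mem p)).2 p rfl).self_of_nhds hp

theorem arcAt_adv_eq {p : Circles D.n} {I : Set ℝ} (hI : IsPreconnected I)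
    (h : ∀ s ∈ I, adv p s ∉ D.under) {s t : ℝ} (hs : s ∈ I) (ht : t ∈ I) :
    D.arcAt (adv p s) (h s hs) = D.arcAt (adv p t) (h t ht) := by
  have h1 : IsPreconnected ((↑) ⁻¹' (adv p '' I) : Set {p : Circles D.n // p ∉ D.under}) := by
    have e : (Subtype.val : {p : Circles D.n // p ∉ D.under} → Circles D.n) ''
        (Subtype.val ⁻¹' (adv p '' I)) = adv p '' I :=
      image_preimage_eq_of_subset (by rintro _ ⟨u, hu, rfl⟩; exact ⟨⟨_, h u hu⟩, rfl⟩)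
    refine (IsInducing.subtypeVal (t := {p | p ∉ D.under})).isPreconnected_image.1 ?_
    exact e.symm ▸ hI.image _ (continuous_adv p).continuousOn
  refine ConnectedComponents.coe_eq_coe'.2 ?_
  exact h1.subset_connectedComponent (x := ⟨adv p t, h t ht⟩) ⟨t, ht, rfl⟩
    (show (⟨adv p s, h s hs⟩ : {p : Circles D.n // p ∉ D.under}) ∈ _ from ⟨s, hs, rfl⟩)

theorem eventually_arcAt {p : Circles D.n} (hp : p ∉ D.under) :
    ∀ᶠ r in 𝓝 p, ∃ h, D.arcAt r h = D.arcAt p hp := by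
  rw [← eventually_adv]
  obtain ⟨δ, hδ, hball⟩ := Metric.eventually_nhds_iff_ball.1
    (eventually_adv.2 (D.eventually_notMem_under hp))
  filter_upwards [Metric.ball_mem_nhds 0 hδ] with s hs
  have := arcAt_adv_eq (convex_ball (0 : ℝ) δ).isPreconnected hball hs (Metric.mem_ball_self hδ)
  refine ⟨hball s hs, this.trans ?_⟩
  congr 1
  exact adv_zero p

theorem exists_eventually_arcAt_gt (q : Circles D.n) :
    ∃ a, ∀ᶠ s in 𝓝[>] (0 : ℝ), ∃ h, D.arcAt (adv q s) h = a := by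
  obtain ⟨δ, hδ, h⟩ := (mem_nhdsGT_iff_exists_Ioo_subset (a := (0 : ℝ))).1
    ((D.eventually_adv_regular q).filter_mono nhdsGT_le_nhdsNE)
  have h' : ∀ s ∈ Ioo 0 δ, adv q s ∉ D.under := fun s hs => Regular.notMem_under (h hs)
  obtain ⟨t, ht⟩ := nonempty_Ioo.2 (mem_Ioi.1 hδ)
  refine ⟨D.arcAt (adv q t) (h' t ht), ?_⟩
  filter_upwards [Ioo_mem_nhdsGT (mem_Ioi.1 hδ)] with s hs
  exact ⟨h' s hs, arcAt_adv_eq isPreconnected_Ioo h' hs ht⟩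

theorem exists_eventually_arcAt_lt (q : Circles D.n) :
    ∃ a, ∀ᶠ s in 𝓝[<] (0 : ℝ), ∃ h, D.arcAt (adv q s) h = a := by
  obtain ⟨δ, hδ, h⟩ := (mem_nhdsLT_iff_exists_Ioo_subset (a := (0 : ℝ))).1
    ((D.eventually_adv_regular q).filter_mono nhdsLT_le_nhdsNE)
  have h' : ∀ s ∈ Ioo δ 0, adv q s ∉ D.under := fun s hs => Regular.notMem_under (h hs)
  obtain ⟨t, ht⟩ := nonempty_Ioo.2 (mem_Iio.1 hδ)
  refine ⟨D.arcAt (adv q t) (h' t ht), ?_⟩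
  filter_upwards [Ioo_mem_nhdsLT (mem_Iio.1 hδ)] with s hs
  exact ⟨h' s hs, arcAt_adv_eq isPreconnected_Ioo h' hs ht⟩

theorem departs_iff {a : D.Arc} {q : Circles D.n} :
    D.Departs a q ↔ ∀ᶠ s in 𝓝[>] (0 : ℝ), ∃ h, D.arcAt (adv q s) h = a := Iff.rfl

theorem arrives_iff {a : D.Arc} {q : Circles D.n} :
    D.Arrives a q ↔ ∀ᶠ s in 𝓝[<] (0 : ℝ), ∃ h, D.arcAt (adv q s) h = a := by
  have h1 : ∀ s : ℝ, (q.1, q.2 - (s : UnitAddCircle)) = adv q (-s) := fun s => by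
    simp [adv, sub_eq_add_neg]
  have h2 : 𝓝[<] (0 : ℝ) = map (fun s => -s) (𝓝[>] 0) := by
    simp
  rw [h2, eventually_map]
  simp only [Arrives]
  refine eventually_congr (Eventually.of_forall fun s => ?_)
  rw [h1]

open Classical in
variable (D) in
/-- A function on the arcs as a function on the circles. -/
def onCircles (μ : D.Arc → G) (p : Circles D.n) : G :=
  if h : p ∉ D.under then μ (D.arcAt p h) else 1

theorem onCircles_apply (μ : D.Arc → G) {p : Circles D.n} (h : p ∉ D.under) :
    D.onCircles μ p = μ (D.arcAt p h) := dif_pos h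

theorem eventually_onCircles (μ : D.Arc → G) {p : Circles D.n} (hp : p ∉ D.under) :
    ∀ᶠ r in 𝓝 p, D.onCircles μ r = D.onCircles μ p := by
  filter_upwards [eventually_arcAt hp] with r ⟨hr, h⟩
  rw [onCircles_apply μ hr, onCircles_apply μ hp, h]

theorem onCircles_map {G' : Type*} [Group G'] (μ : D.Arc → G) (φ : G →* G') :
    D.onCircles (fun a => φ (μ a)) = fun p => φ (D.onCircles μ p) := by
  funext p
  by_cases h : p ∉ D.under
  · rw [onCircles_apply _ h, onCircles_apply _ h]
  · simp [onCircles, h]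

/-- Crossings are isolated on the circles, so every arc contains regular points. -/
theorem onCircles_ext {μ μ' : D.Arc → G}
    (h : ∀ p, D.Regular p → D.onCircles μ p = D.onCircles μ' p) : μ = μ' := by
  funext a
  obtain ⟨⟨p, hp⟩, rfl⟩ := a.exists_rep
  have h1 := (eventually_adv.2 (eventually_onCircles μ hp)).filter_mono
    (nhdsWithin_le_nhds (s := {(0 : ℝ)}ᶜ))
  have h2 := (eventually_adv.2 (eventually_onCircles μ' hp)).filter_mono
    (nhdsWithin_le_nhds (s := {(0 : ℝ)}ᶜ))
  obtain ⟨s, h1, h2, h3⟩ := (h1.and (h2.and (D.eventually_adv_regular p))).exists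
  have := h _ h3
  rw [h1, h2, onCircles_apply μ hp, onCircles_apply μ' hp] at this
  exact this

/-- The colorings of the circles by elements of a group are the functions on the arcs that satisfy
the Wirtinger relations. -/
theorem isColoring_onCircles_iff {μ : D.Arc → G} :
    D.IsColoring (D.onCircles μ) ↔ ∀ r ∈ D.wirtingerRels, FreeGroup.lift μ r = 1 := by
  have hev : ∀ {q : Circles D.n} {a : D.Arc} {l : Filter ℝ},
      (∀ᶠ s in l, ∃ h, D.arcAt (adv q s) h = a) → ∀ᶠ s in l, D.onCircles μ (adv q s) = μ a := by
    intro q a l h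
    filter_upwards [h] with s ⟨hs, h⟩
    rw [onCircles_apply μ hs, h]
  constructor
  · rintro hm _ ⟨p, q, h, b, c, hbc, rfl⟩
    obtain ⟨l, r, hl, hr, h1, h2⟩ := hm.crossing p q h
    rw [onCircles_apply μ h.2.2.1] at h1 h2
    rw [map_mul, map_inv, map_mul, map_mul, FreeGroup.lift_apply_of, FreeGroup.lift_apply_of,
      FreeGroup.lift_apply_of, mul_inv_eq_one]
    rcases hbc with ⟨hd, hc, hb⟩ | ⟨hd, hc, hb⟩
    · obtain ⟨s, h3, h4⟩ := ((hev (arrives_iff.1 hc)).and hl).exists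
      obtain ⟨t, h5, h6⟩ := ((hev (departs_iff.1 hb)).and hr).exists
      rw [← h3, h4, ← h5, h6]
      exact h1 hd
    · obtain ⟨s, h3, h4⟩ := ((hev (arrives_iff.1 hb)).and hl).exists
      obtain ⟨t, h5, h6⟩ := ((hev (departs_iff.1 hc)).and hr).exists
      rw [← h3, h4, ← h5, h6]
      exact h2 hd
  · intro h
    refine ⟨fun p hp => eventually_onCircles μ hp, fun p q hpq => ?_⟩
    obtain ⟨a, ha⟩ := exists_eventually_arcAt_lt q
    obtain ⟨b, hb⟩ := exists_eventually_arcAt_gt q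
    refine ⟨μ a, μ b, hev ha, hev hb, fun hd => ?_, fun hd => ?_⟩
    · have := h _ ⟨p, q, hpq, b, a, Or.inl ⟨hd, arrives_iff.2 ha, departs_iff.2 hb⟩, rfl⟩
      rw [map_mul, map_inv, map_mul, map_mul, FreeGroup.lift_apply_of, FreeGroup.lift_apply_of,
        FreeGroup.lift_apply_of, mul_inv_eq_one] at this
      rwa [onCircles_apply μ hpq.2.2.1]
    · have := h _ ⟨p, q, hpq, a, b, Or.inr ⟨hd, departs_iff.2 hb, arrives_iff.2 ha⟩, rfl⟩
      rw [map_mul, map_inv, map_mul, map_mul, FreeGroup.lift_apply_of, FreeGroup.lift_apply_of,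
        FreeGroup.lift_apply_of, mul_inv_eq_one] at this
      rwa [onCircles_apply μ hpq.2.2.1]

theorem IsCrossing.regionInDirection_iff {p q : Circles D.n} {Q : SignType → SignType → D.Region}
    (hQ : ∀ i j : ℝ, i ≠ 0 → j ≠ 0 → ∀ R, D.RegionInDirection R (D.curve p)
        (i • velocity D.curve p + j • velocity D.curve q) ↔
        R = Q (SignType.sign i) (SignType.sign j)) (R : D.Region) :
    (D.RegionInDirection R (D.curve p) (-velocity D.curve p - velocity D.curve q) ↔
      R = Q (-1) (-1)) ∧
    (D.RegionInDirection R (D.curve p) (-velocity D.curve p + velocity D.curve q) ↔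
      R = Q (-1) 1) ∧
    (D.RegionInDirection R (D.curve p) (velocity D.curve p - velocity D.curve q) ↔
      R = Q 1 (-1)) ∧
    (D.RegionInDirection R (D.curve p) (velocity D.curve p + velocity D.curve q) ↔
      R = Q 1 1) := by
  have h1 := hQ (-1) (-1) (by norm_num) (by norm_num) R
  have h2 := hQ (-1) 1 (by norm_num) (by norm_num) R
  have h3 := hQ 1 (-1) (by norm_num) (by norm_num) R
  have h4 := hQ 1 1 (by norm_num) (by norm_num) R
  simp only [Left.sign_neg, sign_one, neg_smul, one_smul, ← sub_eq_add_neg] at h1 h2 h3 h4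
  exact ⟨h1, h2, h3, h4⟩

theorem IsCrossing.eventually_onSurface {p q : Circles D.n} {C : D.CrossingChart p q}
    {Q : SignType → SignType → D.Region}
    (hQ : ∀ᶠ y in 𝓝[S.carrier] D.curve p, (C.ζ y).1 ≠ 0 → (C.ζ y).2 ≠ 0 →
        ∃ h, D.regionAt y h = Q (SignType.sign (C.ζ y).1) (SignType.sign (C.ζ y).2))
    (F : D.Region → G) : ∀ᶠ y in 𝓝[S.carrier] D.curve p, (C.ζ y).1 ≠ 0 → (C.ζ y).2 ≠ 0 →
        D.onSurface 1 F y = F (Q (SignType.sign (C.ζ y).1) (SignType.sign (C.ζ y).2)) := by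
  filter_upwards [hQ] with y hy h1 h2
  obtain ⟨h, h3⟩ := hy h1 h2
  rw [onSurface_apply _ _ h, h3]

/-- The overstrand has the colour `m p` just before and just after the crossing, so `A⁻¹B` and
`C⁻¹D` are both `m p`, or both its inverse, according to the sign of the crossing. -/
theorem IsPotential.lift_dehnRels {m : Circles D.n → G} (hm : D.IsColoring m)
    {F : D.Region → G} (hF : D.IsPotential m F) :
    ∀ r ∈ D.dehnRels, FreeGroup.lift F r = 1 := by
  rintro _ ⟨p, q, hpq, RA, RB, RC, RD, hA, hB, hC, hD, rfl⟩
  obtain ⟨C⟩ := nonempty_crossingChart hpq.1 hpq.2.1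
  obtain ⟨Q, hQ, hdir⟩ := hpq.exists_quadrant_regions RA C
  rw [(IsCrossing.regionInDirection_iff hdir _).1] at hA
  rw [(IsCrossing.regionInDirection_iff hdir _).2.1] at hB
  rw [(IsCrossing.regionInDirection_iff hdir _).2.2.1] at hC
  rw [(IsCrossing.regionInDirection_iff hdir _).2.2.2] at hD
  have h1 := hpq.eventually_jump_fst_iff C (F := fun i j => F (Q i j))
    (IsCrossing.eventually_onSurface hQ F)
  have h2 := nhdsWithin_le_nhds (s := {(0 : ℝ)}ᶜ) (eventually_adv.2 (hm.eventually_eq p hpq.2.2.1))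
  have h3 : ∀ᶠ s in 𝓝[≠] (0 : ℝ), F (Q (SignType.sign s) (SignType.sign (D.crossingDet p q))) =
      F (Q (SignType.sign s) (-SignType.sign (D.crossingDet p q))) * m p := by
    filter_upwards [h1, h2, D.eventually_adv_regular p] with s h1 h2 h3
    exact (h1 _).1 (h2 ▸ hF.jump h3)
  obtain ⟨s, hs, hs0⟩ := ((h3.filter_mono nhdsGT_le_nhdsNE).and
    (self_mem_nhdsWithin : ∀ᶠ s in 𝓝[>] (0 : ℝ), s ∈ Ioi 0)).exists
  obtain ⟨t, ht, ht0⟩ := ((h3.filter_mono nhdsLT_le_nhdsNE).and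
    (self_mem_nhdsWithin : ∀ᶠ s in 𝓝[<] (0 : ℝ), s ∈ Iio 0)).exists
  rw [sign_pos hs0] at hs
  rw [sign_neg ht0] at ht
  simp only [map_mul, map_inv, FreeGroup.lift_apply_of, mul_inv_eq_one]
  rw [hA, hB, hC, hD]
  rcases lt_or_gt_of_ne (crossingDet_ne_zero hpq.1 hpq.2.1) with h | h
  · rw [sign_neg h, neg_neg] at hs ht
    rw [hs, ht]; group
  · rw [sign_pos h] at hs ht
    rw [hs, ht]; group

/-- At a regular point there is a single pair of sides. At an overcrossing the Dehn relation says
that the jumps across the two halves of the overstrand coincide, so the jump continues through the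
crossing. -/
theorem exists_jump_of_lift_dehnRels {F : D.Region → G} (R₀ : D.Region)
    (hF : ∀ r ∈ D.dehnRels, FreeGroup.lift F r = 1) {p : Circles D.n} (hp : p ∉ D.under) :
    ∃ g, ∀ᶠ r in 𝓝 p, D.Regular r → D.Jump (D.onSurface 1 F) r g := by
  by_cases hreg : D.Regular p
  · obtain ⟨C⟩ := D.nonempty_strandChart p
    obtain ⟨Φ, hΦ⟩ := (locConst_onSurface 1 F (D.curve p)).exists_sides hreg C
    refine ⟨(Φ (-1))⁻¹ * Φ 1, ?_⟩
    filter_upwards [Regular.eventually_jump_iff C hΦ] with r hr _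
    rw [hr, mul_inv_cancel_left]
  · rcases D.trichotomy (D.curve p) with h | ⟨r, hr, hrp⟩ | ⟨p', q, hpq, hp'⟩
    · exact absurd ⟨p, rfl⟩ h
    · exact absurd (hr p hrp.symm ▸ hr) hreg
    rcases hpq.eq_or_eq hp'.symm with rfl | rfl
    · obtain ⟨C⟩ := nonempty_crossingChart hpq.1 hpq.2.1
      obtain ⟨Q, hQ, hdir⟩ := hpq.exists_quadrant_regions R₀ C
      have h1 := hpq.eventually_jump_fst_iff C (F := fun i j => F (Q i j))
        (IsCrossing.eventually_onSurface hQ F)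
      have h2 := hF _ ⟨p, q, hpq, Q (-1) (-1), Q (-1) 1, Q 1 (-1), Q 1 1,
        (IsCrossing.regionInDirection_iff hdir _).1.2 rfl,
        (IsCrossing.regionInDirection_iff hdir _).2.1.2 rfl,
        (IsCrossing.regionInDirection_iff hdir _).2.2.1.2 rfl,
        (IsCrossing.regionInDirection_iff hdir _).2.2.2.2 rfl, rfl⟩
      simp only [map_mul, map_inv, FreeGroup.lift_apply_of, mul_inv_eq_one] at h2
      simp_rw [eventually_adv_punctured hreg]
      have h3 : ∃ g, F (Q (-1) (SignType.sign (D.crossingDet p q))) =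
          F (Q (-1) (-SignType.sign (D.crossingDet p q))) * g ∧
          F (Q 1 (SignType.sign (D.crossingDet p q))) =
          F (Q 1 (-SignType.sign (D.crossingDet p q))) * g := by
        rcases lt_or_gt_of_ne (crossingDet_ne_zero hpq.1 hpq.2.1) with h | h
        · rw [sign_neg h, neg_neg]
          refine ⟨((F (Q (-1) (-1)))⁻¹ * F (Q (-1) 1))⁻¹, by group, ?_⟩
          rw [h2]; group
        · rw [sign_pos h]
          refine ⟨(F (Q (-1) (-1)))⁻¹ * F (Q (-1) 1), by group, ?_⟩
          rw [h2]; group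
      obtain ⟨g, hg1, hg2⟩ := h3
      refine ⟨g, ?_⟩
      filter_upwards [h1, self_mem_nhdsWithin] with s h1 hs
      rw [h1]
      rcases lt_or_gt_of_ne hs with h | h
      · rwa [sign_neg h]
      · rwa [sign_pos h]
    · exact absurd hpq.2.2.2 hp

/-- The jumps of `F` are locally constant off the undercrossings, hence a function on arcs. The
Wirtinger relation then holds automatically, since the jumps around a crossing are quotients of the
four values of `F` there. -/
theorem exists_isColoring_of_lift_dehnRels {F : D.Region → G} (R₀ : D.Region)
    (hF : ∀ r ∈ D.dehnRels, FreeGroup.lift F r = 1) :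
    ∃ μ : D.Arc → G, D.IsColoring (D.onCircles μ) ∧ D.IsPotential (D.onCircles μ) F := by
  classical
  have key : ∀ p, ∃ g, (p ∉ D.under → ∀ᶠ r in 𝓝 p, D.Regular r → D.Jump (D.onSurface 1 F) r g) ∧
      -- At undercrossings the value is set to `1`, the default in `onCircles`, so that the two
      -- functions agree everywhere.
      (p ∈ D.under → g = 1) := by
    intro p
    by_cases hp : p ∈ D.under
    · exact ⟨1, fun h => absurd hp h, fun _ => rfl⟩
    · obtain ⟨g, hg⟩ := exists_jump_of_lift_dehnRels R₀ hF hp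
      exact ⟨g, fun _ => hg, fun h => absurd h hp⟩
  choose m hm hm1 using key
  have hjump : ∀ p, D.Regular p → D.Jump (D.onSurface 1 F) p (m p) := fun p hp =>
    (hm p hp.notMem_under).self_of_nhds hp
  have hev : ∀ p ∉ D.under, ∀ᶠ r in 𝓝 p, m r = m p := by
    intro p hp
    filter_upwards [hm p hp, D.eventually_regular p] with r h1 h2
    by_cases hr : r = p
    · rw [hr]
    · exact (hjump r (h2 hr)).unique (h1 (h2 hr))
  have hpot : D.IsPotential m F := fun x hx => ⟨locConst_onSurface 1 F x, fun p _ =>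
    Eventually.of_forall hjump⟩
  let _ : TopologicalSpace G := ⊥
  have : DiscreteTopology G := ⟨rfl⟩
  have hcont : Continuous fun p : {p : Circles D.n // p ∉ D.under} => m p := by
    rw [continuous_iff_continuousAt]
    intro p
    have h1 := continuous_subtype_val.continuousAt.eventually (hev p p.2)
    exact (tendsto_const_nhds.congr' (h1.mono fun y hy => hy.symm) :)
  let μ : D.Arc → G := hcont.connectedComponentsLift
  have hμ : D.onCircles μ = m := by
    funext p
    by_cases hp : p ∉ D.under
    · rw [onCircles_apply μ hp]; rfl
    · rw [hm1 p (not_not.1 hp)]; simp [onCircles, hp]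
  refine ⟨μ, ?_, hμ ▸ hpot⟩
  rw [hμ]
  refine ⟨hev, fun p q hpq => ?_⟩
  obtain ⟨C⟩ := nonempty_crossingChart hpq.1 hpq.2.1
  obtain ⟨Q, hQ, -⟩ := hpq.exists_quadrant_regions R₀ C
  have h1 := hpq.eventually_jump_fst_iff C (F := fun i j => F (Q i j))
    (IsCrossing.eventually_onSurface hQ F)
  have h2 := hpq.eventually_jump_snd_iff C (F := fun i j => F (Q i j))
    (IsCrossing.eventually_onSurface hQ F)
  have h3 : ∀ᶠ s in 𝓝[≠] (0 : ℝ), F (Q (SignType.sign s) (SignType.sign (D.crossingDet p q))) =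
      F (Q (SignType.sign s) (-SignType.sign (D.crossingDet p q))) * m p := by
    filter_upwards [h1, nhdsWithin_le_nhds (s := {(0 : ℝ)}ᶜ) (eventually_adv.2 (hev p hpq.2.2.1)),
      D.eventually_adv_regular p] with s h1 h2 h3
    exact (h1 _).1 (h2 ▸ hjump _ h3)
  have h4 : ∀ᶠ s in 𝓝[≠] (0 : ℝ), F (Q (-SignType.sign (D.crossingDet p q)) (SignType.sign s)) =
      F (Q (SignType.sign (D.crossingDet p q)) (SignType.sign s)) * m (adv q s) := by
    filter_upwards [h2, D.eventually_adv_regular q] with s h1 h3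
    exact (h1 _).1 (hjump _ h3)
  set σ := SignType.sign (D.crossingDet p q) with hσ
  obtain ⟨s, hs, hs0⟩ := ((h3.filter_mono nhdsGT_le_nhdsNE).and
    (self_mem_nhdsWithin : ∀ᶠ s in 𝓝[>] (0 : ℝ), s ∈ Ioi 0)).exists
  obtain ⟨t, ht, ht0⟩ := ((h3.filter_mono nhdsLT_le_nhdsNE).and
    (self_mem_nhdsWithin : ∀ᶠ s in 𝓝[<] (0 : ℝ), s ∈ Iio 0)).exists
  rw [sign_pos hs0] at hs
  rw [sign_neg ht0] at ht
  -- These are the jumps of `F` across the understrand before and after the crossing.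
  refine ⟨(F (Q σ (-1)))⁻¹ * F (Q (-σ) (-1)), (F (Q σ 1))⁻¹ * F (Q (-σ) 1), ?_, ?_,
    fun hd => ?_, fun hd => ?_⟩
  · filter_upwards [h4.filter_mono nhdsLT_le_nhdsNE, self_mem_nhdsWithin] with u hu hu0
    rw [sign_neg hu0] at hu
    rw [hu, inv_mul_cancel_left]
  · filter_upwards [h4.filter_mono nhdsGT_le_nhdsNE, self_mem_nhdsWithin] with u hu hu0
    rw [sign_pos hu0] at hu
    rw [hu, inv_mul_cancel_left]
  · rw [hσ, sign_pos hd] at hs ht ⊢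
    rw [hs, ht]; group
  · rw [hσ, sign_neg hd, neg_neg] at hs ht ⊢
    rw [hs, ht]; group

end OrientedLinkDiagram

end

/-! ### The two mutually inverse homomorphisms -/

open OrientedLinkDiagram in
theorem mainTheorem2 (S : LinkDiag.Surface) (D : OrientedLinkDiagram S) (R₀ : D.Region) :
    Nonempty (D.WirtingerGroup ≃* D.DehnGroup R₀) := by
  let ι : D.Region → D.DehnGroup R₀ := PresentedGroup.of
  let κ : D.Arc → D.WirtingerGroup := PresentedGroup.of
  have hι : ∀ r ∈ insert (FreeGroup.of R₀) D.dehnRels, FreeGroup.lift ι r = 1 := fun r hr => by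
    have : FreeGroup.lift ι = PresentedGroup.mk _ := by ext; simp [ι, PresentedGroup.of]
    rw [this]
    exact PresentedGroup.one_of_mem hr
  have hκ : ∀ r ∈ D.wirtingerRels, FreeGroup.lift κ r = 1 := fun r hr => by
    have : FreeGroup.lift κ = PresentedGroup.mk _ := by ext; simp [κ, PresentedGroup.of]
    rw [this]
    exact PresentedGroup.one_of_mem hr
  have hι₀ : ι R₀ = 1 := by simpa using hι _ (Set.mem_insert _ _)
  obtain ⟨μ, hμ, hμι⟩ := exists_isColoring_of_lift_dehnRels R₀
    fun r hr => hι r (Set.mem_insert_of_mem _ hr)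
  have hκ' := isColoring_onCircles_iff.2 hκ
  obtain ⟨F, hF, hF₀⟩ := hκ'.exists_isPotential R₀
  let Φ : D.WirtingerGroup →* D.DehnGroup R₀ :=
    PresentedGroup.toGroup (isColoring_onCircles_iff.1 hμ)
  let Ψ : D.DehnGroup R₀ →* D.WirtingerGroup := PresentedGroup.toGroup (f := F) (by
    rintro r (rfl | hr)
    · simpa using hF₀
    · exact hF.lift_dehnRels hκ' r hr)
  have hΦ : ∀ a, Φ (κ a) = μ a := fun a => PresentedGroup.toGroup.of _
  have hΨ : ∀ R, Ψ (ι R) = F R := fun R => PresentedGroup.toGroup.of _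
  -- Both sides are potentials for `μ` with value `1` at `R₀`.
  have h1 : (fun R => Φ (F R)) = ι := by
    have h2 := hF.map Φ
    have h3 : (fun p => Φ (D.onCircles κ p)) = D.onCircles μ := by
      rw [← onCircles_map]
      simp only [hΦ]
    rw [h3] at h2
    refine h2.eq hμ hμι (R₀ := R₀) ?_
    rw [hF₀, map_one, hι₀]
  -- Both sides give the jumps of the same function `F`, since `Ψ` carries the potential `ι` to `F`.
  have h4 : (fun a => Ψ (μ a)) = κ := by
    refine onCircles_ext fun p hp => ?_
    have h5 := (hμι.map Ψ).jump hp
    simp only [hΨ] at h5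
    rw [onCircles_map]
    exact h5.unique (hF.jump hp)
  refine ⟨MonoidHom.toMulEquiv Φ Ψ ?_ ?_⟩
  · refine PresentedGroup.ext fun a => ?_
    change Ψ (Φ (κ a)) = κ a
    rw [hΦ]
    exact congrFun h4 a
  · refine PresentedGroup.ext fun R => ?_
    change Φ (Ψ (ι R)) = ι R
    rw [hΨ]
    exact congrFun h1 R
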